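/- Let $n\ge 1$, let $\alpha>1$, $k>0$ and $p,q$ be real numbers, and write $\hat p_t(x)=(4\pi t)^{-n/2}e^{-|x|^2/(4t)}$ and $e^{t\Delta}U=\hat p_t*U$. For $T>0$ let $X_T=L^q_w((0,T),L^p(\mathbb{R}^n))$ with $w(t)=t^k$, i.e. the measurable $F$ on $\mathbb{R}^n\times(0,T)$ with $\int_0^T\|F(\cdot,t)\|_{L^p}^q\,t^k\,dt<\infty$. A weight is a measurable $v:\mathbb{R}^n\to(0,\infty)$ such that $v\,dx$ is a Radon measure; $L^p_v$ is the space of measurable $f$ with $\int|f|^pv\,dx<\infty$; and $v\in D_p$ means that $v$ is a weight and there are $t_0>0$ and $x\in\mathbb{R}^n$ with $v^{-1/p}\,\hat p_{t_0}(x-\cdot)\in L^{p'}(\mathbb{R}^n)$, $\frac1p+\frac1{p'}=1$. Let $U:\mathbb{R}^n\to\mathbb{R}$. A mild solution on $\mathbb{R}^n\times(0,T)$ of $\partial_tu-\Delta u=|u|^{\alpha-1}u$, $u(\cdot,0)=U$, is a function $u$ such that, for almost every $x$ and every $t\in(0,T)$, $$u(x,t)=\hat p_t*U(x)+\int_0^t\int_{\mathbb{R}^n}\hat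 p_{t-s}(x-y)\,|u(y,s)|^{\alpha-1}u(y,s)\,dy\,ds ,$$ both integrals being absolutely convergent. Theorem. Assume $$\min\{p,q\}>\alpha,\qquad \frac{k\alpha}{q-\alpha}<1,\qquad \beta:=\frac n2\Big(\frac{\alpha-1}{p}\Big)\Big(\frac{q}{q-\alpha}\Big)<1,$$ $$k+(q-\alpha)\Big(1-\beta-\frac{k\alpha}{q-\alpha}\Big)>-1,\qquad k<q-1 .$$ Suppose that $(x,t)\mapsto e^{t\Delta}U(x)$ belongs to $X_{T_0}$ for some $T_0>0$, and that $U\in L^p_{\tilde v}(\mathbb{R}^n)$ for some $\tilde v\in D_p$. Then there are $T\in(0,T_0]$ and a mild solution $u\in X_T$ on $\mathbb{R}^n\times(0,T)$. Moreover, for every $T>0$, every mild solution $u\in X_T$ on $\mathbb{R}^n\times(0,T)$ satisfies $\lim_{t\to0^+}u(x,t)=U(x)$ for almost every $x\in\mathbb{R}^n$. -/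

import Mathlib

open MeasureTheory Set Filter Topology

noncomputable section

/-- Euclidean space `ℝⁿ`. -/
abbrev Rn (n : ℕ) : Type := EuclideanSpace ℝ (Fin n)

/-- The Gauss–Weierstrass kernel `(4πt)^{-n/2} exp(-|x|²/(4t))`, used for `t > 0`. -/
def heatKernel (n : ℕ) (t : ℝ) (x : Rn n) : ℝ :=
  (4 * Real.pi * t) ^ (-(n : ℝ) / 2) * Real.exp (-‖x‖ ^ 2 / (4 * t))

/-- `(e^{tΔ} U)(x)`, the convolution of the heat kernel at time `t` with `U`. -/
def heatExtension {n : ℕ} (U : Rn n → ℝ) (x : Rn n) (t : ℝ) : ℝ :=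
  ∫ y, heatKernel n t (x - y) * U y

/-- A weight: a strictly positive measurable function `v` such that `v dx` is a Radon measure. -/
structure IsWeight {n : ℕ} (v : Rn n → ℝ) : Prop where
  measurable : Measurable v
  pos : ∀ x, 0 < v x
  locallyIntegrable : LocallyIntegrable v volume

/-- The class `D_p`, for `1 ≤ p < ∞`: weights `v` for which `v^{-1/p} p_{t₀}(x - ·)` lies in
`L^{p'}` for some time `t₀ > 0` and some point `x`, where `1/p + 1/p' = 1`. -/
def WeightClassD {n : ℕ} (p : ℝ) (v : Rn n → ℝ) : Prop :=
  IsWeight v ∧ ∃ t₀ : ℝ, 0 < t₀ ∧ ∃ x : Rn n,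
    MemLp (fun y => v y ^ (-1 / p) * heatKernel n t₀ (x - y))
      (ENNReal.conjExponent (ENNReal.ofReal p)) volume

/-- `U ∈ L^p_v(ℝⁿ)`, i.e. `∫ |U|^p v dx < ∞`. -/
def MemWeightedLp {n : ℕ} (p : ℝ) (v U : Rn n → ℝ) : Prop :=
  MemLp U (ENNReal.ofReal p) (volume.withDensity fun x => ENNReal.ofReal (v x))

/-- `F ∈ X_T = L^q_w((0,T), L^p(ℝⁿ))` with `w(t) = t^k`, i.e. `F` is measurable on
`ℝⁿ × (0,T)` and `∫₀ᵀ ‖F(·,t)‖_{L^p}^q t^k dt < ∞`. -/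
def MemX {n : ℕ} (p q k T : ℝ) (F : Rn n → ℝ → ℝ) : Prop :=
  AEStronglyMeasurable (fun z : Rn n × ℝ => F z.1 z.2)
      ((volume : Measure (Rn n)).prod (volume.restrict (Ioo 0 T))) ∧
    ∫⁻ t in Ioo 0 T, eLpNorm (fun x => F x t) (ENNReal.ofReal p) volume ^ q *
      ENNReal.ofReal (t ^ k) < ⊤

/-- The power nonlinearity `N(r) = |r|^{α-1} r`. -/
def powerNL (α r : ℝ) : ℝ := |r| ^ (α - 1) * r

/-- `u` is a mild solution on `ℝⁿ × (0,T)` of `∂ₜu - Δu = |u|^{α-1}u`, `u(·,0) = U`: for almost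
every `x` and every `t ∈ (0,T)` the two integrals in the Duhamel formula converge absolutely
and the formula holds at `(x,t)`. -/
def IsMildSolution {n : ℕ} (α T : ℝ) (U : Rn n → ℝ) (u : Rn n → ℝ → ℝ) : Prop :=
  ∀ᵐ x : Rn n, ∀ t ∈ Ioo 0 T,
    Integrable (fun y => heatKernel n t (x - y) * U y) volume ∧
    Integrable (fun z : ℝ × Rn n => heatKernel n (t - z.1) (x - z.2) * powerNL α (u z.2 z.1))
      ((volume.restrict (Ioo 0 t)).prod volume) ∧
    u x t = heatExtension U x t +
      ∫ s in Ioo 0 t, ∫ y, heatKernel n (t - s) (x - y) * powerNL α (u y s)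

end

open scoped ENNReal

/-!
The equation `w(·, t) = |e^{tΔ} U| + ∫₀ᵗ e^{(t-s)Δ} w(·, s)^α ds` is solved in `[0, ∞]` by monotone
iteration. Smoothing of the heat semigroup from `L^{p/α}` to `L^p` and Hölder's inequality in time
bound the Duhamel term in `X_T` by `C(T) ‖w‖^α`: the conditions `kα/(q-α) < 1` and `β < 1` make a
beta integral converge, and the condition on `k + (q-α)(1-β-kα/(q-α))` gives `C(T) → 0`. Hence the
iterates stay bounded in `X_T` for small `T`.

With `N(r) = |r|^{α-1} r`, a signed `u` solves the original equation when `z = u + w` solves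
`z = (e^{tΔ} U + |e^{tΔ} U|) + ∫₀ᵗ e^{(t-s)Δ} (N(z - w) + w^α) ds`, whose right-hand side is
nonnegative and monotone in `z`. Since `2w` is a supersolution, monotone iteration gives a solution
`z ≤ 2w`, that is, `|u| ≤ w`.

For the initial trace, `e^{tΔ} U → U` at the Lebesgue points of `U`, and the Duhamel term is at most
a constant times `∫₀ᵗ M(|u(·, s)|^α) ds` with `M` the maximal function of the heat semigroup. By
Kolmogorov's inequality `M` maps `L^{p/α}` to `L^1_loc`, so this integral is finite for almost every
`x`, and then it tends to `0` with `t`.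
-/

section MeasureSpaces

variable {X S : Type*} [MeasurableSpace X] [MeasurableSpace S] {μ : Measure X} {ν : Measure S}

lemma eLpNorm_ofReal_eq_lintegral_rpow {p : ℝ} (hp : 0 < p) (f : X → ℝ≥0∞) :
    eLpNorm f (ENNReal.ofReal p) μ = (∫⁻ x, f x ^ p ∂μ) ^ (1 / p) := by
  rw [eLpNorm_eq_lintegral_rpow_enorm_toReal (ENNReal.ofReal_pos.2 hp).ne' ENNReal.ofReal_ne_top,
    ENNReal.toReal_ofReal hp.le]
  simp only [enorm_eq_self]

lemma eLpNorm_ofReal_rpow {p : ℝ} (hp : 0 < p) (f : X → ℝ≥0∞) :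
    eLpNorm f (ENNReal.ofReal p) μ ^ p = ∫⁻ x, f x ^ p ∂μ := by
  rw [eLpNorm_ofReal_eq_lintegral_rpow hp, ← ENNReal.rpow_mul, one_div_mul_cancel hp.ne',
    ENNReal.rpow_one]

lemma ennreal_iSup_rpow {ι : Sort*} {r : ℝ} (hr : 0 < r) (a : ι → ℝ≥0∞) :
    (⨆ j, a j) ^ r = ⨆ j, a j ^ r :=
  (ENNReal.orderIsoRpow r hr).map_iSup a

lemma eLpNorm_ofReal_iSup {p : ℝ} (hp : 0 < p) {f : ℕ → X → ℝ≥0∞} (hf : ∀ j, Measurable (f j))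
    (hmono : ∀ x, Monotone fun j => f j x) :
    eLpNorm (fun x => ⨆ j, f j x) (ENNReal.ofReal p) μ =
      ⨆ j, eLpNorm (f j) (ENNReal.ofReal p) μ := by
  simp_rw [eLpNorm_ofReal_eq_lintegral_rpow hp, ennreal_iSup_rpow hp]
  rw [lintegral_iSup (fun j => (hf j).pow_const p)
    fun i j hij x => ENNReal.rpow_le_rpow (hmono x hij) hp.le, ennreal_iSup_rpow (by positivity)]

lemma lintegral_mul_rpow_le {b : ℝ} (hb : 1 ≤ b) {f g : X → ℝ≥0∞} (hf : Measurable f)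
    (hg : Measurable g) :
    (∫⁻ x, f x * g x ∂μ) ^ b ≤ (∫⁻ x, f x ∂μ) ^ (b - 1) * ∫⁻ x, f x * g x ^ b ∂μ := by
  have hb0 : 0 < b := by linarith
  have h := eLpNorm'_le_eLpNorm'_mul_rpow_measure_univ one_pos hb
    (hg.aestronglyMeasurable (μ := μ.withDensity f))
  simp only [eLpNorm', enorm_eq_self, ENNReal.rpow_one, div_one,
    lintegral_withDensity_eq_lintegral_mul _ hf hg,
    lintegral_withDensity_eq_lintegral_mul _ hf (hg.pow_const b), Pi.mul_apply,
    withDensity_apply _ MeasurableSet.univ, setLIntegral_univ] at h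
  refine (ENNReal.rpow_le_rpow h hb0.le).trans_eq ?_
  rw [ENNReal.mul_rpow_of_nonneg _ _ hb0.le, ← ENNReal.rpow_mul, ← ENNReal.rpow_mul,
    one_div_mul_cancel hb0.ne', ENNReal.rpow_one, mul_comm]
  congr 2
  field_simp

lemma lintegral_eLpNorm_mul_div_rpow {p : ℝ} (hp : 0 < p) {f : X → ℝ≥0∞}
    (hf : eLpNorm f (ENNReal.ofReal p) μ ≠ ⊤) :
    ∫⁻ x, eLpNorm f (ENNReal.ofReal p) μ * (f x / eLpNorm f (ENNReal.ofReal p) μ) ^ p ∂μ =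
      eLpNorm f (ENNReal.ofReal p) μ := by
  have hpow := eLpNorm_ofReal_rpow (μ := μ) hp f
  generalize eLpNorm f (ENNReal.ofReal p) μ = a at hf hpow ⊢
  rcases eq_or_ne a 0 with rfl | ha0
  · simp only [zero_mul, lintegral_zero]
  have hap : a ^ p ≠ 0 := (ENNReal.rpow_pos (pos_iff_ne_zero.2 ha0) hf).ne'
  simp only [div_eq_mul_inv, ENNReal.mul_rpow_of_nonneg _ _ hp.le, ENNReal.inv_rpow]
  rw [lintegral_const_mul' _ _ hf, lintegral_mul_const' _ _ (ENNReal.inv_ne_top.2 hap), ← hpow,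
    ENNReal.mul_inv_cancel hap (by finiteness), mul_one]

/-- Mathlib's layer cake formula is for real-valued functions. -/
lemma lintegral_eq_lintegral_meas_ofReal_lt {f : X → ℝ≥0∞} (hf : Measurable f) :
    ∫⁻ x, f x ∂μ = ∫⁻ c in Ioi (0 : ℝ), μ {x | ENNReal.ofReal c < f x} := by
  by_cases h : ∀ᵐ x ∂μ, f x ≠ ⊤
  · calc ∫⁻ x, f x ∂μ = ∫⁻ x, ENNReal.ofReal (f x).toReal ∂μ :=
          lintegral_congr_ae (h.mono fun x hx => (ENNReal.ofReal_toReal hx).symm)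
      _ = ∫⁻ c in Ioi (0 : ℝ), μ {x | c < (f x).toReal} :=
          lintegral_eq_lintegral_meas_lt μ (ae_of_all _ fun x => ENNReal.toReal_nonneg)
            hf.ennreal_toReal.aemeasurable
      _ = ∫⁻ c in Ioi (0 : ℝ), μ {x | ENNReal.ofReal c < f x} :=
          setLIntegral_congr_fun measurableSet_Ioi fun c hc => measure_congr <|
            h.mono fun x hx => propext (ENNReal.ofReal_lt_iff_lt_toReal (le_of_lt hc) hx).symm
  · have hpos : μ {x | f x = ⊤} ≠ 0 := by simpa only [ae_iff, not_not] using h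
    rw [lintegral_eq_top_of_measure_eq_top_ne_zero hf.aemeasurable hpos, eq_comm, eq_top_iff]
    calc (⊤ : ℝ≥0∞) = ∫⁻ _ in Ioi (0 : ℝ), μ {x | f x = ⊤} := by
          rw [setLIntegral_const, Real.volume_Ioi, ENNReal.mul_top hpos]
      _ ≤ ∫⁻ c in Ioi (0 : ℝ), μ {x | ENNReal.ofReal c < f x} :=
          lintegral_mono fun _ => measure_mono fun x (hx : f x = ⊤) =>
            ENNReal.ofReal_lt_top.trans_eq hx.symm

lemma setLIntegral_Ioi_div_rpow {A b : ℝ} (hA : 0 < A) (hb : 1 < b) :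
    ∫⁻ c in Ioi A, ENNReal.ofReal ((A / c) ^ b) = ENNReal.ofReal A * ENNReal.ofReal (b - 1)⁻¹ := by
  have hdiv : ∀ c ∈ Ioi A, ENNReal.ofReal ((A / c) ^ b) = ENNReal.ofReal (A ^ b * c ^ (-b)) :=
    fun c hc => by
      have hc0 : 0 < c := hA.trans hc
      rw [Real.div_rpow hA.le hc0.le, Real.rpow_neg hc0.le, div_eq_mul_inv]
  have hnonneg : 0 ≤ᵐ[volume.restrict (Ioi A)] fun c => A ^ b * c ^ (-b) :=
    ae_restrict_of_forall_mem measurableSet_Ioi fun c hc => by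
      have hc0 : 0 < c := hA.trans hc
      positivity
  rw [setLIntegral_congr_fun measurableSet_Ioi hdiv, ← ofReal_integral_eq_lintegral_ofReal
      ((integrableOn_Ioi_rpow_of_lt (by linarith) hA).const_mul _) hnonneg,
    integral_const_mul, integral_Ioi_rpow_of_lt (by linarith) hA, ← ENNReal.ofReal_mul hA.le]
  congr 1
  rw [Real.rpow_add hA, Real.rpow_neg hA.le, Real.rpow_one]
  have : A ^ b ≠ 0 := by positivity
  have : -b + 1 ≠ 0 := by linarith
  have : b - 1 ≠ 0 := by linarith
  field_simp
  ring

lemma lintegral_le_of_meas_lt_le {A b : ℝ} (hA : 0 < A) (hb : 1 < b) {f : X → ℝ≥0∞}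
    (hf : Measurable f)
    (hweak : ∀ c, 0 < c → μ {x | ENNReal.ofReal c < f x} ≤ ENNReal.ofReal ((A / c) ^ b)) :
    ∫⁻ x, f x ∂μ ≤ ENNReal.ofReal A * (μ univ + ENNReal.ofReal (b - 1)⁻¹) := by
  rw [lintegral_eq_lintegral_meas_ofReal_lt hf, ← Ioc_union_Ioi_eq_Ioi hA.le, mul_add]
  refine (lintegral_union_le _ _ _).trans (add_le_add ?_ ?_)
  · calc ∫⁻ c in Ioc 0 A, μ {x | ENNReal.ofReal c < f x} ≤ ∫⁻ _ in Ioc 0 A, μ univ :=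
          lintegral_mono fun c => measure_mono (subset_univ _)
      _ = ENNReal.ofReal A * μ univ := by
          rw [setLIntegral_const, Real.volume_Ioc, sub_zero, mul_comm]
  · rw [← setLIntegral_Ioi_div_rpow hA hb]
    exact setLIntegral_mono' measurableSet_Ioi fun c hc => hweak c (hA.trans hc)

variable [SFinite μ] [SFinite ν] {F : X → S → ℝ≥0∞}

lemma ae_ae_of_ae_prod_swap {P : X × S → Prop} (h : ∀ᵐ z ∂μ.prod ν, P z) :
    ∀ᵐ s ∂ν, ∀ᵐ x ∂μ, P (x, s) :=
  Measure.ae_ae_of_ae_prod (Measure.measurePreserving_swap.quasiMeasurePreserving.ae h)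

lemma measurable_eLpNorm_slice {p : ℝ} (hp : 0 < p) (hF : Measurable (Function.uncurry F)) :
    Measurable fun s => eLpNorm (F · s) (ENNReal.ofReal p) μ := by
  simp only [eLpNorm_ofReal_eq_lintegral_rpow hp]
  exact (hF.pow_const p).lintegral_prod_left'.pow_const _

lemma ae_ae_eq_zero_of_eLpNorm_slice_eq_zero {p : ℝ} (hp : 0 < p)
    (hF : Measurable (Function.uncurry F)) :
    ∀ᵐ x ∂μ, ∀ᵐ s ∂ν, eLpNorm (F · s) (ENNReal.ofReal p) μ = 0 → F x s = 0 := by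
  have ha := measurable_eLpNorm_slice (μ := μ) hp hF
  refine (Measure.ae_ae_comm ?_).2 (ae_of_all _ fun s => ?_)
  · exact ((measurableSet_singleton 0).preimage (ha.comp measurable_snd)).imp
      (hF (measurableSet_singleton 0))
  · by_cases h : eLpNorm (F · s) (ENNReal.ofReal p) μ = 0
    · have hs := (eLpNorm_eq_zero_iff hF.of_uncurry_right.aestronglyMeasurable
        (ENNReal.ofReal_pos.2 hp).ne').1 h
      exact hs.mono fun x hx _ => hx
    · exact ae_of_all _ fun x hx => absurd hx h

/-- Jensen's inequality for the weight given by the norms of the slices. -/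
lemma eLpNorm_lintegral_le {p : ℝ} (hp : 1 ≤ p) (hF : Measurable (Function.uncurry F)) :
    eLpNorm (fun x => ∫⁻ s, F x s ∂ν) (ENNReal.ofReal p) μ ≤
      ∫⁻ s, eLpNorm (F · s) (ENNReal.ofReal p) μ ∂ν := by
  have hp0 : 0 < p := by linarith
  set a : S → ℝ≥0∞ := fun s => eLpNorm (F · s) (ENNReal.ofReal p) μ
  have ha : Measurable a := measurable_eLpNorm_slice hp0 hF
  rcases eq_or_ne (∫⁻ s, a s ∂ν) ⊤ with htop | htop
  · exact htop ▸ le_top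
  have hfin : ∀ᵐ s ∂ν, a s ≠ ⊤ := (ae_lt_top ha htop).mono fun s hs => hs.ne
  have hG : Measurable fun z : X × S => a z.2 * (F z.1 z.2 / a z.2) ^ p :=
    (ha.comp measurable_snd).mul ((hF.div (ha.comp measurable_snd)).pow_const p)
  have hnormalize : ∀ᵐ x ∂μ, ∫⁻ s, F x s ∂ν = ∫⁻ s, a s * (F x s / a s) ∂ν := by
    filter_upwards [ae_ae_eq_zero_of_eLpNorm_slice_eq_zero (ν := ν) hp0 hF] with x hx
    refine lintegral_congr_ae ?_
    filter_upwards [hx, hfin] with s hzero hs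
    exact (ENNReal.mul_div_cancel' hzero fun h => absurd h hs).symm
  rw [← ENNReal.rpow_le_rpow_iff hp0, eLpNorm_ofReal_rpow hp0]
  calc ∫⁻ x, (∫⁻ s, F x s ∂ν) ^ p ∂μ
      = ∫⁻ x, (∫⁻ s, a s * (F x s / a s) ∂ν) ^ p ∂μ :=
        lintegral_congr_ae (hnormalize.mono fun x hx => by simp only [hx])
    _ ≤ ∫⁻ x, (∫⁻ s, a s ∂ν) ^ (p - 1) * ∫⁻ s, a s * (F x s / a s) ^ p ∂ν ∂μ :=
        lintegral_mono fun x => lintegral_mul_rpow_le hp ha (hF.of_uncurry_left.div ha)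
    _ = (∫⁻ s, a s ∂ν) ^ (p - 1) * ∫⁻ s, ∫⁻ x, a s * (F x s / a s) ^ p ∂μ ∂ν := by
        rw [lintegral_const_mul _ hG.lintegral_prod_right',
          lintegral_lintegral_swap hG.aemeasurable]
    _ ≤ (∫⁻ s, a s ∂ν) ^ (p - 1) * ∫⁻ s, a s ∂ν := by
        gcongr 1
        exact lintegral_mono_ae (hfin.mono fun s hs => (lintegral_eLpNorm_mul_div_rpow hp0 hs).le)
    _ = (∫⁻ s, a s ∂ν) ^ p := by
        nth_rw 2 [← ENNReal.rpow_one (∫⁻ s, a s ∂ν)]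
        rw [← ENNReal.rpow_add_of_nonneg _ _ (by linarith) zero_le_one, sub_add_cancel]

end MeasureSpaces

section TimeIntegrals

open ProbabilityTheory (beta beta_pos)

lemma setLIntegral_Ioo_zero_one_beta {β κ : ℝ} (hβ : β < 1) (hκ : κ < 1) :
    ∫⁻ s in Ioo (0 : ℝ) 1, ENNReal.ofReal ((1 - s) ^ (-β) * s ^ (-κ)) =
      ENNReal.ofReal (beta (1 - κ) (1 - β)) := by
  have hB : 0 < beta (1 - κ) (1 - β) := beta_pos (by linarith) (by linarith)
  have hpdf := ProbabilityTheory.lintegral_betaPDF_eq_one (α := 1 - κ) (β := 1 - β)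
    (by linarith) (by linarith)
  rw [ProbabilityTheory.lintegral_betaPDF] at hpdf
  calc ∫⁻ s in Ioo (0 : ℝ) 1, ENNReal.ofReal ((1 - s) ^ (-β) * s ^ (-κ))
      = ∫⁻ s in Ioo (0 : ℝ) 1, ENNReal.ofReal (beta (1 - κ) (1 - β)) * ENNReal.ofReal
          (1 / beta (1 - κ) (1 - β) * s ^ (1 - κ - 1) * (1 - s) ^ (1 - β - 1)) := by
        refine lintegral_congr fun s => ?_
        rw [← ENNReal.ofReal_mul hB.le, sub_sub_cancel_left, sub_sub_cancel_left]
        congr 1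
        field_simp
    _ = ENNReal.ofReal (beta (1 - κ) (1 - β)) := by
        rw [lintegral_const_mul' _ _ ENNReal.ofReal_ne_top, hpdf, mul_one]

lemma setLIntegral_Ioo_beta {β κ t : ℝ} (hβ : β < 1) (hκ : κ < 1) (ht : 0 < t) :
    ∫⁻ s in Ioo 0 t, ENNReal.ofReal ((t - s) ^ (-β) * s ^ (-κ)) =
      ENNReal.ofReal (beta (1 - κ) (1 - β) * t ^ (1 - β - κ)) := by
  have himage : Ioo 0 t = (t * ·) '' Ioo 0 1 := by rw [image_mul_left_Ioo ht, mul_zero, mul_one]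
  rw [himage, lintegral_image_eq_lintegral_abs_deriv_mul measurableSet_Ioo
    (fun s _ => ((hasDerivAt_id' s).const_mul t).hasDerivWithinAt)
    (mul_right_injective₀ ht.ne').injOn, mul_one, abs_of_pos ht,
    mul_comm (beta _ _), ENNReal.ofReal_mul (by positivity), ← setLIntegral_Ioo_zero_one_beta hβ hκ,
    ← lintegral_const_mul' _ _ ENNReal.ofReal_ne_top]
  refine setLIntegral_congr_fun measurableSet_Ioo fun s ⟨hs0, hs1⟩ => ?_
  have hs1' : 0 < 1 - s := by linarith
  rw [← ENNReal.ofReal_mul ht.le, ← ENNReal.ofReal_mul (by positivity)]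
  congr 1
  rw [show t - t * s = t * (1 - s) by ring, Real.mul_rpow ht.le hs1'.le,
    Real.mul_rpow ht.le hs0.le, show 1 - β - κ = 1 + -β + -κ by ring, Real.rpow_add ht,
    Real.rpow_add ht, Real.rpow_one]
  ring

lemma holderConjugate_div_sub {α q : ℝ} (hα : 0 < α) (hαq : α < q) :
    (q / (q - α)).HolderConjugate (q / α) := by
  have hqα : 0 < q - α := by linarith
  have hq : 0 < q := by linarith
  rw [Real.holderConjugate_iff]
  refine ⟨by rw [lt_div_iff₀ hqα]; linarith, ?_⟩
  rw [inv_div, inv_div, ← add_div, sub_add_cancel, div_self hq.ne']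

/-- Hölder's inequality with exponents `q / (q - α)` and `q / α`, after splitting off the factor
`s ^ (k * α / q)` for the weight. -/
lemma setLIntegral_sub_rpow_mul_rpow_le {α q k γ t : ℝ} (hα : 0 < α) (hαq : α < q)
    (hκ : k * α / (q - α) < 1) (hβ : γ * (q / (q - α)) < 1) (ht : 0 < t)
    {m : ℝ → ℝ≥0∞} (hm : Measurable m) :
    ∫⁻ s in Ioo 0 t, ENNReal.ofReal ((t - s) ^ (-γ)) * m s ^ α ≤
      ENNReal.ofReal (beta (1 - k * α / (q - α)) (1 - γ * (q / (q - α))) *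
          t ^ (1 - γ * (q / (q - α)) - k * α / (q - α))) ^ ((q - α) / q) *
        (∫⁻ s in Ioo 0 t, m s ^ q * ENNReal.ofReal (s ^ k)) ^ (α / q) := by
  have hqα : 0 < q - α := by linarith
  have hq : 0 < q := by linarith
  have hholder := ENNReal.lintegral_mul_le_Lp_mul_Lq (volume.restrict (Ioo 0 t))
    (holderConjugate_div_sub hα hαq)
    (f := fun s => ENNReal.ofReal ((t - s) ^ (-γ) * s ^ (-(k * α / q))))
    (g := fun s => m s ^ α * ENNReal.ofReal (s ^ (k * α / q))) (by fun_prop) (by fun_prop)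
  rw [one_div_div, one_div_div] at hholder
  calc ∫⁻ s in Ioo 0 t, ENNReal.ofReal ((t - s) ^ (-γ)) * m s ^ α
      = ∫⁻ s in Ioo 0 t, ENNReal.ofReal ((t - s) ^ (-γ) * s ^ (-(k * α / q))) *
          (m s ^ α * ENNReal.ofReal (s ^ (k * α / q))) := by
        refine setLIntegral_congr_fun measurableSet_Ioo fun s ⟨hs0, hst⟩ => ?_
        have : 0 < t - s := by linarith
        rw [mul_comm (m s ^ α), ← mul_assoc, ← ENNReal.ofReal_mul (by positivity), mul_assoc,
          ← Real.rpow_add hs0, neg_add_cancel, Real.rpow_zero, mul_one]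
    _ ≤ _ := hholder
    _ = _ := by
        rw [← setLIntegral_Ioo_beta hβ hκ ht]
        congr 2 <;> refine setLIntegral_congr_fun measurableSet_Ioo fun s ⟨hs0, hst⟩ => ?_
        · have hts : 0 < t - s := by linarith
          rw [ENNReal.ofReal_rpow_of_nonneg (by positivity) (by positivity),
            Real.mul_rpow (by positivity) (by positivity), ← Real.rpow_mul hts.le,
            ← Real.rpow_mul hs0.le]
          congr 3
          · ring
          · field_simp
        · rw [ENNReal.mul_rpow_of_nonneg _ _ (by positivity), ← ENNReal.rpow_mul,
            ENNReal.ofReal_rpow_of_nonneg (by positivity) (by positivity), ← Real.rpow_mul hs0.le]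
          congr 3 <;> field_simp

lemma tendsto_setLIntegral_Ioo_zero {f : ℝ → ℝ≥0∞} {T : ℝ} (hT : 0 < T)
    (hfin : ∫⁻ s in Ioo 0 T, f s < ⊤) :
    Tendsto (fun t => ∫⁻ s in Ioo 0 t, f s) (𝓝[>] 0) (𝓝 0) := by
  have hvolume : Tendsto (volume.restrict (Ioo 0 T) ∘ Ioo 0) (𝓝[>] 0) (𝓝 0) := by
    have h := (ENNReal.continuous_ofReal.tendsto 0).mono_left
      (nhdsWithin_le_nhds (s := Ioi (0 : ℝ)))
    rw [ENNReal.ofReal_zero] at h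
    refine tendsto_of_tendsto_of_tendsto_of_le_of_le tendsto_const_nhds h
      (fun _ => zero_le) fun t => ?_
    exact (Measure.restrict_apply_le _ _).trans_eq (by rw [Real.volume_Ioo, sub_zero])
  refine (tendsto_setLIntegral_zero hfin.ne hvolume).congr' ?_
  filter_upwards [Ioo_mem_nhdsGT hT] with t ht
  rw [Measure.restrict_restrict measurableSet_Ioo,
    inter_eq_left.2 (Ioo_subset_Ioo_right ht.2.le)]

lemma setLIntegral_mul_rpow_rpow_lt_top {b e k : ℝ} (hb : 0 ≤ b) (he : -1 < k + b * e) {T : ℝ}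
    (hT : 0 < T) (a : ℝ) :
    ∫⁻ t in Ioo 0 T, ENNReal.ofReal (a * t ^ e) ^ b * ENNReal.ofReal (t ^ k) < ⊤ := by
  have hint := ((intervalIntegral.integrableOn_Ioo_rpow_iff hT).2 he).lintegral_lt_top
  calc ∫⁻ t in Ioo 0 T, ENNReal.ofReal (a * t ^ e) ^ b * ENNReal.ofReal (t ^ k)
      = ∫⁻ t in Ioo 0 T, ENNReal.ofReal a ^ b * ENNReal.ofReal (t ^ (k + b * e)) := by
        refine setLIntegral_congr_fun measurableSet_Ioo fun t ⟨ht, _⟩ => ?_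
        rw [ENNReal.ofReal_mul' (by positivity), ENNReal.mul_rpow_of_nonneg _ _ hb,
          ENNReal.ofReal_rpow_of_nonneg (Real.rpow_nonneg ht.le e) hb, ← Real.rpow_mul ht.le,
          mul_assoc,
          ← ENNReal.ofReal_mul (by positivity), ← Real.rpow_add ht, mul_comm e, add_comm]
    _ = ENNReal.ofReal a ^ b * ∫⁻ t in Ioo 0 T, ENNReal.ofReal (t ^ (k + b * e)) :=
        lintegral_const_mul _ (by fun_prop)
    _ < ⊤ := ENNReal.mul_lt_top (ENNReal.rpow_lt_top_of_nonneg hb ENNReal.ofReal_ne_top) hint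

end TimeIntegrals

section Balls

variable {E : Type*} [NormedAddCommGroup E] [NormedSpace ℝ E] [FiniteDimensional ℝ E]
  [MeasurableSpace E] [BorelSpace E] {μ : Measure E} [μ.IsAddHaarMeasure]

lemma measure_ball_four_mul (x : E) (r : ℝ) :
    μ (Metric.ball x (4 * r)) = 4 ^ Module.finrank ℝ E * μ (Metric.ball x r) := by
  rw [Measure.addHaar_ball_mul_of_pos _ _ (by norm_num), Measure.addHaar_ball_center _ x,
    ENNReal.ofReal_pow (by norm_num), ENNReal.ofReal_ofNat]

lemma mul_measure_setOf_lt_measure_ball_of_radius_le (ν : Measure E) (c : ℝ≥0∞) (R : ℝ) :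
    c * μ {x | ∃ r ∈ Ioc 0 R, c * μ (Metric.ball x r) < ν (Metric.ball x r)} ≤
      4 ^ Module.finrank ℝ E * ν univ := by
  set S := {x | ∃ r ∈ Ioc 0 R, c * μ (Metric.ball x r) < ν (Metric.ball x r)}
  choose! r hr hlt using fun x (hx : x ∈ S) => hx
  obtain ⟨u, huS, hdisj, hcov⟩ := Vitali.exists_disjoint_subfamily_covering_enlargement_ball
    S id r R (fun x hx => (hr x hx).2) 4 (by norm_num)
  simp only [id] at hdisj hcov
  have hcount : u.Countable := hdisj.countable_of_isOpen (fun x _ => Metric.isOpen_ball)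
    (fun x hx => ⟨x, Metric.mem_ball_self (hr x (huS hx)).1⟩)
  have hsub : S ⊆ ⋃ x ∈ u, Metric.ball x (4 * r x) := fun x hx => by
    obtain ⟨b, hb, hxb⟩ := hcov x hx
    exact mem_biUnion hb (hxb (Metric.mem_ball_self (hr x hx).1))
  calc c * μ S ≤ c * ∑' x : u, μ (Metric.ball x.1 (4 * r x)) := by
        gcongr
        exact (measure_mono hsub).trans (measure_biUnion_le _ hcount _)
    _ = 4 ^ Module.finrank ℝ E * ∑' x : u, c * μ (Metric.ball x.1 (r x)) := by
        simp_rw [measure_ball_four_mul, ENNReal.tsum_mul_left]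
        ring
    _ ≤ 4 ^ Module.finrank ℝ E * ∑' x : u, ν (Metric.ball x.1 (r x)) := by
        gcongr with x
        exact (hlt x.1 (huS x.2)).le
    _ = 4 ^ Module.finrank ℝ E * ν (⋃ x ∈ u, Metric.ball x (r x)) := by
        rw [measure_biUnion hcount hdisj fun x _ => Metric.isOpen_ball.measurableSet]
    _ ≤ 4 ^ Module.finrank ℝ E * ν univ := by
        gcongr
        exact subset_univ _

lemma mul_measure_setOf_lt_measure_ball (ν : Measure E) (c : ℝ≥0∞) :
    c * μ {x | ∃ r > 0, c * μ (Metric.ball x r) < ν (Metric.ball x r)} ≤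
      4 ^ Module.finrank ℝ E * ν univ := by
  have hUnion : {x | ∃ r > 0, c * μ (Metric.ball x r) < ν (Metric.ball x r)} =
      ⋃ m : ℕ, {x | ∃ r ∈ Ioc 0 (m : ℝ), c * μ (Metric.ball x r) < ν (Metric.ball x r)} := by
    ext x
    simp only [mem_ofPred_eq, mem_iUnion]
    refine ⟨fun ⟨r, hr, h⟩ => ?_, fun ⟨m, r, hr, h⟩ => ⟨r, hr.1, h⟩⟩
    obtain ⟨m, hm⟩ := exists_nat_ge r
    exact ⟨m, r, ⟨hr, hm⟩, h⟩
  rw [hUnion, Monotone.measure_iUnion, ENNReal.mul_iSup]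
  · exact iSup_le fun m => mul_measure_setOf_lt_measure_ball_of_radius_le ν c m
  · rintro m m' hm x ⟨r, hr, h⟩
    exact ⟨r, ⟨hr.1, hr.2.trans (by exact_mod_cast hm)⟩, h⟩

lemma ae_exists_setLIntegral_ball_enorm_sub_le {F : Type*} [NormedAddCommGroup F] {U : E → F}
    (hU : LocallyIntegrable U μ) :
    ∀ᵐ x ∂μ, ∀ ε : ℝ≥0∞, ε ≠ 0 → ∃ R > 0, ∀ r ∈ Ioc 0 R,
      ∫⁻ y in Metric.ball x r, ‖U y - U x‖ₑ ∂μ ≤ ε * μ (Metric.ball x r) := by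
  filter_upwards [(IsUnifLocDoublingMeasure.vitaliFamily μ
    1).ae_tendsto_lintegral_enorm_sub_div hU] with x hx ε hε
  have hcentered : ∀ᶠ r in 𝓝[>] (0 : ℝ), x ∈ Metric.closedBall x (1 * r) :=
    eventually_mem_nhdsWithin.mono fun r (hr : 0 < r) =>
      Metric.mem_closedBall_self (by linarith)
  have hlim := hx.comp (IsUnifLocDoublingMeasure.tendsto_closedBall_filterAt μ (K := 1) (x := x)
    (fun _ => x) id tendsto_id hcentered)
  obtain ⟨R, hR, hsmall⟩ := mem_nhdsGT_iff_exists_Ioc_subset.1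
    (hlim.eventually (ge_mem_nhds (pos_iff_ne_zero.2 hε)))
  refine ⟨R, hR, fun r hr => ?_⟩
  have haverage : (∫⁻ y in Metric.closedBall x r, ‖U y - U x‖ₑ ∂μ) /
      μ (Metric.closedBall x r) ≤ ε := hsmall hr
  rw [ENNReal.div_le_iff (Metric.measure_closedBall_pos _ _ hr.1).ne'
    measure_closedBall_lt_top.ne, Measure.addHaar_closedBall _ _ hr.1.le,
    ← Measure.addHaar_ball_of_pos _ x hr.1] at haverage
  exact (lintegral_mono_set Metric.ball_subset_closedBall).trans haverage

end Balls

section HeatKernel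

variable {n : ℕ} {s t R : ℝ} {x : Rn n}

lemma heatKernel_pos (ht : 0 < t) (x : Rn n) : 0 < heatKernel n t x := by
  unfold heatKernel
  positivity

lemma continuous_heatKernel (t : ℝ) : Continuous (heatKernel n t) := by
  unfold heatKernel
  fun_prop

@[fun_prop]
lemma measurable_heatKernel {A : Type*} [MeasurableSpace A] {τ : A → ℝ} {X : A → Rn n}
    (hτ : Measurable τ) (hX : Measurable X) : Measurable fun a => heatKernel n (τ a) (X a) := by
  unfold heatKernel
  fun_prop

lemma heatKernel_sub_comm (t : ℝ) (x y : Rn n) :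
    heatKernel n t (x - y) = heatKernel n t (y - x) := by
  unfold heatKernel
  rw [norm_sub_rev]

lemma enorm_heatKernel (ht : 0 < t) (x : Rn n) :
    ‖heatKernel n t x‖ₑ = ENNReal.ofReal (heatKernel n t x) :=
  Real.enorm_of_nonneg (heatKernel_pos ht x).le

lemma integral_heatKernel (ht : 0 < t) : ∫ x, heatKernel n t x = 1 := by
  have hexponent : ∀ x : Rn n, -‖x‖ ^ 2 / (4 * t) = -(1 / (4 * t)) * ‖x‖ ^ 2 := fun x => by ring
  simp_rw [heatKernel, integral_const_mul, hexponent]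
  rw [GaussianFourier.integral_rexp_neg_mul_sq_norm (by positivity), finrank_euclideanSpace_fin,
    show Real.pi / (1 / (4 * t)) = 4 * Real.pi * t by field_simp, ← Real.rpow_add (by positivity),
    neg_div, neg_add_cancel, Real.rpow_zero]

lemma integrable_heatKernel (ht : 0 < t) : Integrable (heatKernel n t) :=
  .of_integral_ne_zero (by rw [integral_heatKernel ht]; exact one_ne_zero)

lemma lintegral_enorm_heatKernel_sub (ht : 0 < t) (x : Rn n) :
    ∫⁻ y, ‖heatKernel n t (x - y)‖ₑ = 1 := by
  rw [lintegral_sub_left_eq_self (fun y => ‖heatKernel n t y‖ₑ)]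
  simp only [enorm_heatKernel ht]
  rw [← ofReal_integral_eq_lintegral_ofReal (integrable_heatKernel ht)
    (ae_of_all _ fun y => (heatKernel_pos ht y).le), integral_heatKernel ht, ENNReal.ofReal_one]

lemma heatKernel_le (ht : 0 < t) (x : Rn n) :
    heatKernel n t x ≤ (4 * Real.pi * t) ^ (-(n : ℝ) / 2) := by
  refine mul_le_of_le_one_right (by positivity) (Real.exp_le_one_iff.2 ?_)
  exact div_nonpos_of_nonpos_of_nonneg (neg_nonpos.2 (sq_nonneg _)) (by positivity)

lemma heatKernel_prefactor_eq (n : ℕ) (hs : 0 < s) (ht : 0 < t) :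
    (4 * Real.pi * s) ^ (-(n : ℝ) / 2) =
      (t / s) ^ ((n : ℝ) / 2) * (4 * Real.pi * t) ^ (-(n : ℝ) / 2) := by
  rw [show 4 * Real.pi * t = (t / s) * (4 * Real.pi * s) by field_simp,
    Real.mul_rpow (x := t / s) (by positivity) (by positivity), ← mul_assoc,
    ← Real.rpow_add (by positivity), neg_div, add_neg_cancel, Real.rpow_zero, one_mul]

lemma heatKernel_le_mul_of_le_norm (hs : 0 < s) (hst : s ≤ t) (hR : 0 ≤ R) (hx : R ≤ ‖x‖) :
    heatKernel n s x ≤ (t / s) ^ ((n : ℝ) / 2) *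
      Real.exp (-R ^ 2 * (1 / (4 * s) - 1 / (4 * t))) * heatKernel n t x := by
  have ht : 0 < t := hs.trans_le hst
  have hexponent : -‖x‖ ^ 2 / (4 * s) ≤
      -R ^ 2 * (1 / (4 * s) - 1 / (4 * t)) + -‖x‖ ^ 2 / (4 * t) := by
    have hrate : 0 ≤ 1 / (4 * s) - 1 / (4 * t) := by
      rw [sub_nonneg]
      gcongr
    calc -‖x‖ ^ 2 / (4 * s)
        = -(‖x‖ ^ 2 * (1 / (4 * s) - 1 / (4 * t))) + -‖x‖ ^ 2 / (4 * t) := by ring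
      _ ≤ -(R ^ 2 * (1 / (4 * s) - 1 / (4 * t))) + -‖x‖ ^ 2 / (4 * t) := by gcongr
      _ = _ := by ring
  calc heatKernel n s x
      ≤ (t / s) ^ ((n : ℝ) / 2) * (4 * Real.pi * t) ^ (-(n : ℝ) / 2) *
          Real.exp (-R ^ 2 * (1 / (4 * s) - 1 / (4 * t)) + -‖x‖ ^ 2 / (4 * t)) := by
        rw [heatKernel, heatKernel_prefactor_eq n hs ht]
        gcongr
    _ = _ := by
        rw [heatKernel, Real.exp_add]
        ring

lemma heatKernel_le_mul (hs : 0 < s) (hst : s ≤ t) (x : Rn n) :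
    heatKernel n s x ≤ (t / s) ^ ((n : ℝ) / 2) * heatKernel n t x := by
  simpa using heatKernel_le_mul_of_le_norm hs hst le_rfl (norm_nonneg x)

/-- `‖x + a‖² ≤ 2‖x‖² + 2‖a‖²`, so doubling the time absorbs a translation of the kernel. -/
lemma heatKernel_add_le_mul (ht : 0 < t) (x a : Rn n) :
    heatKernel n t x ≤ 2 ^ ((n : ℝ) / 2) * Real.exp (‖a‖ ^ 2 / (4 * t)) *
      heatKernel n (2 * t) (x + a) := by
  have hexponent : -‖x‖ ^ 2 / (4 * t) ≤
      ‖a‖ ^ 2 / (4 * t) + -‖x + a‖ ^ 2 / (4 * (2 * t)) := by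
    have hparallelogram := parallelogram_law_with_norm ℝ x a
    rw [← sub_nonneg, show ‖a‖ ^ 2 / (4 * t) + -‖x + a‖ ^ 2 / (4 * (2 * t)) -
      -‖x‖ ^ 2 / (4 * t) = (2 * (‖x‖ ^ 2 + ‖a‖ ^ 2) - ‖x + a‖ ^ 2) / (8 * t) by
        field_simp; ring]
    exact div_nonneg (by nlinarith [mul_self_nonneg ‖x - a‖]) (by positivity)
  calc heatKernel n t x
      ≤ 2 ^ ((n : ℝ) / 2) * (4 * Real.pi * (2 * t)) ^ (-(n : ℝ) / 2) *
          Real.exp (‖a‖ ^ 2 / (4 * t) + -‖x + a‖ ^ 2 / (4 * (2 * t))) := by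
        rw [heatKernel, heatKernel_prefactor_eq n ht (by positivity : 0 < 2 * t),
          mul_div_cancel_right₀ _ ht.ne']
        gcongr
    _ = _ := by
        rw [heatKernel, Real.exp_add]
        ring

lemma tendsto_heatKernel_tail_factor (n : ℕ) (ht : 0 < t) (hR : 0 < R) :
    Tendsto (fun s : ℝ => (t / s) ^ ((n : ℝ) / 2) *
      Real.exp (-R ^ 2 * (1 / (4 * s) - 1 / (4 * t)))) (𝓝[>] 0) (𝓝 0) := by
  have hdecay := ((tendsto_rpow_mul_exp_neg_mul_atTop_nhds_zero ((n : ℝ) / 2) (R ^ 2 / (4 * t))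
    (by positivity)).comp (tendsto_inv_nhdsGT_zero.const_mul_atTop ht)).mul_const
      (Real.exp (R ^ 2 / (4 * t)))
  rw [zero_mul] at hdecay
  refine hdecay.congr' ?_
  filter_upwards [self_mem_nhdsWithin] with s (hs : 0 < s)
  rw [Function.comp_apply, mul_assoc, ← Real.exp_add, ← div_eq_mul_inv]
  congr 2
  field_simp
  ring

lemma setOf_lt_heatKernel {c : ℝ} (ht : 0 < t) (hc : 0 < c) (x : Rn n) :
    {y | c < heatKernel n t (x - y)} = Metric.ball x
      (Real.sqrt (4 * t * Real.log ((4 * Real.pi * t) ^ (-(n : ℝ) / 2) / c))) := by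
  ext y
  have hA : 0 < (4 * Real.pi * t) ^ (-(n : ℝ) / 2) := by positivity
  rw [mem_ofPred_eq, Metric.mem_ball, dist_comm, dist_eq_norm, Real.lt_sqrt (norm_nonneg _),
    heatKernel, ← div_lt_iff₀' hA, ← Real.log_lt_iff_lt_exp (by positivity), ← inv_div,
    Real.log_inv, neg_div (4 * t), neg_lt_neg_iff, div_lt_iff₀' (by positivity)]

lemma lintegral_enorm_heatKernel_sub_eq_lintegral_meas (ht : 0 < t) (x : Rn n)
    (ν : Measure (Rn n)) :
    ∫⁻ y, ‖heatKernel n t (x - y)‖ₑ ∂ν =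
      ∫⁻ c in Ioi (0 : ℝ), ν {y | c < heatKernel n t (x - y)} := by
  simp only [enorm_heatKernel ht]
  exact lintegral_eq_lintegral_meas_lt ν (ae_of_all _ fun y => (heatKernel_pos ht _).le)
    ((continuous_heatKernel t).comp (by fun_prop)).aemeasurable

/-- The heat kernel is a superposition of indicator functions of balls. -/
lemma lintegral_enorm_heatKernel_sub_le_of_ball (ht : 0 < t) (x : Rn n) (ν : Measure (Rn n))
    {A : ℝ≥0∞} (hA : ∀ r > 0, ν (Metric.ball x r) ≤ A * volume (Metric.ball x r)) :
    ∫⁻ y, ‖heatKernel n t (x - y)‖ₑ ∂ν ≤ A := by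
  rcases eq_or_ne A ⊤ with rfl | hA_top
  · exact le_top
  have hball : ∀ r : ℝ, ν (Metric.ball x r) ≤ A * volume (Metric.ball x r) := fun r => by
    rcases le_or_gt r 0 with hr | hr
    · simp only [Metric.ball_eq_empty.2 hr, measure_empty, mul_zero, le_refl]
    · exact hA r hr
  calc ∫⁻ y, ‖heatKernel n t (x - y)‖ₑ ∂ν
      = ∫⁻ c in Ioi (0 : ℝ), ν {y | c < heatKernel n t (x - y)} :=
        lintegral_enorm_heatKernel_sub_eq_lintegral_meas ht x ν
    _ ≤ ∫⁻ c in Ioi (0 : ℝ), A * volume {y | c < heatKernel n t (x - y)} :=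
        setLIntegral_mono' measurableSet_Ioi fun c hc => by
          rw [setOf_lt_heatKernel ht hc]
          exact hball _
    _ = A := by
        rw [lintegral_const_mul' _ _ hA_top, ← lintegral_enorm_heatKernel_sub_eq_lintegral_meas ht,
          lintegral_enorm_heatKernel_sub ht, mul_one]

end HeatKernel

section LHeatExtension

variable {n : ℕ} {t b p : ℝ} {x : Rn n} {g : Rn n → ℝ≥0∞}

/-- The `[0, ∞]`-valued analogue of `heatExtension`, defined without integrability assumptions. -/
noncomputable def lheatExtension (g : Rn n → ℝ≥0∞) (x : Rn n) (t : ℝ) : ℝ≥0∞ :=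
  ∫⁻ y, ‖heatKernel n t (x - y)‖ₑ * g y

lemma measurable_lheatExtension {A : Type*} [MeasurableSpace A] {f : A → Rn n → ℝ≥0∞}
    {X : A → Rn n} {τ : A → ℝ} (hf : Measurable (Function.uncurry f)) (hX : Measurable X)
    (hτ : Measurable τ) : Measurable fun a => lheatExtension (f a) (X a) (τ a) :=
  Measurable.lintegral_prod_right'
    (f := fun w : A × Rn n => ‖heatKernel n (τ w.1) (X w.1 - w.2)‖ₑ * f w.1 w.2)
    (by fun_prop)

lemma lheatExtension_mono {g' : Rn n → ℝ≥0∞} (h : ∀ y, g y ≤ g' y) (x : Rn n) (t : ℝ) :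
    lheatExtension g x t ≤ lheatExtension g' x t :=
  lintegral_mono fun y => mul_le_mul_right (h y) _

lemma lheatExtension_rpow_le (ht : 0 < t) (hb : 1 ≤ b) (hg : Measurable g) (x : Rn n) :
    lheatExtension g x t ^ b ≤ lheatExtension (fun y => g y ^ b) x t := by
  have h := lintegral_mul_rpow_le (μ := volume) (f := fun y => ‖heatKernel n t (x - y)‖ₑ) hb
    (by fun_prop) hg
  rwa [lintegral_enorm_heatKernel_sub ht, ENNReal.one_rpow, one_mul] at h

lemma lheatExtension_le (ht : 0 < t) (g : Rn n → ℝ≥0∞) (x : Rn n) :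
    lheatExtension g x t ≤ ENNReal.ofReal ((4 * Real.pi * t) ^ (-(n : ℝ) / 2)) * ∫⁻ y, g y := by
  rw [← lintegral_const_mul' _ _ ENNReal.ofReal_ne_top]
  refine lintegral_mono fun y => ?_
  gcongr
  rw [enorm_heatKernel ht]
  exact ENNReal.ofReal_le_ofReal (heatKernel_le ht _)

lemma lintegral_lheatExtension (ht : 0 < t) (hg : Measurable g) :
    ∫⁻ x, lheatExtension g x t = ∫⁻ y, g y := by
  unfold lheatExtension
  rw [lintegral_lintegral_swap (by fun_prop)]
  refine lintegral_congr fun y => ?_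
  rw [lintegral_mul_const _ (by fun_prop)]
  simp only [heatKernel_sub_comm t _ y, lintegral_enorm_heatKernel_sub ht, one_mul]

lemma eLpNorm_lheatExtension_le (ht : 0 < t) (hb : 1 ≤ b) (hbp : b ≤ p) (hg : Measurable g) :
    eLpNorm (lheatExtension g · t) (ENNReal.ofReal p) volume ≤
      ENNReal.ofReal ((4 * Real.pi * t) ^ (-(n : ℝ) / 2 * (1 / b - 1 / p))) *
        eLpNorm g (ENNReal.ofReal b) volume := by
  have hb0 : 0 < b := by linarith
  have hp0 : 0 < p := by linarith
  set c := ENNReal.ofReal ((4 * Real.pi * t) ^ (-(n : ℝ) / 2))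
  set N := ∫⁻ y, g y ^ b
  have hd : 0 ≤ (p - b) / b := div_nonneg (by linarith) hb0.le
  have hmass : ∫⁻ x, lheatExtension (fun y => g y ^ b) x t = N :=
    lintegral_lheatExtension ht (hg.pow_const b)
  have hpow : ∀ x, lheatExtension g x t ^ p ≤
      (c * N) ^ ((p - b) / b) * lheatExtension (fun y => g y ^ b) x t := fun x => by
    have hjensen := lheatExtension_rpow_le ht hb hg x
    calc lheatExtension g x t ^ p
        = (lheatExtension g x t ^ b) ^ ((p - b) / b) * lheatExtension g x t ^ b := by
          rw [← ENNReal.rpow_mul, ← ENNReal.rpow_add_of_nonneg _ _ (by positivity) hb0.le]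
          congr 1
          field_simp
          ring
      _ ≤ _ := by
          gcongr
          exact hjensen.trans (lheatExtension_le ht _ x)
  calc eLpNorm (lheatExtension g · t) (ENNReal.ofReal p) volume
      ≤ (∫⁻ x, (c * N) ^ ((p - b) / b) * lheatExtension (fun y => g y ^ b) x t) ^ (1 / p) := by
        rw [eLpNorm_ofReal_eq_lintegral_rpow hp0]
        gcongr with x
        exact hpow x
    _ = c ^ (1 / b - 1 / p) * N ^ (1 / b) := by
        rw [lintegral_const_mul _ (measurable_lheatExtension (X := fun x => x)
            (by fun_prop) measurable_id measurable_const), hmass,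
          ENNReal.mul_rpow_of_nonneg _ _ hd, mul_assoc]
        nth_rw 2 [← ENNReal.rpow_one N]
        rw [← ENNReal.rpow_add_of_nonneg _ _ hd zero_le_one,
          ENNReal.mul_rpow_of_nonneg _ _ (by positivity), ← ENNReal.rpow_mul, ← ENNReal.rpow_mul]
        congr 2 <;> field_simp
        ring
    _ = _ := by
        rw [ENNReal.ofReal_rpow_of_pos (by positivity), ← Real.rpow_mul (by positivity),
          eLpNorm_ofReal_eq_lintegral_rpow hb0]

end LHeatExtension

section HeatMaximal

variable {n : ℕ} {t b : ℝ} {g : Rn n → ℝ≥0∞}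

/-- The maximal function of the heat semigroup. The times are restricted to powers of `2`, so that
it is measurable as a countable supremum. -/
noncomputable def heatMaximal (g : Rn n → ℝ≥0∞) (x : Rn n) : ℝ≥0∞ :=
  ⨆ j : ℤ, lheatExtension g x (2 ^ j)

lemma measurable_heatMaximal {A : Type*} [MeasurableSpace A] {f : A → Rn n → ℝ≥0∞} {X : A → Rn n}
    (hf : Measurable (Function.uncurry f)) (hX : Measurable X) :
    Measurable fun a => heatMaximal (f a) (X a) :=
  Measurable.iSup fun _ => measurable_lheatExtension hf hX measurable_const

lemma enorm_heatKernel_le_mul {s c : ℝ} {x y : Rn n} (hs : 0 < s) (ht : 0 < t)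
    (h : heatKernel n s x ≤ c * heatKernel n t y) :
    ‖heatKernel n s x‖ₑ ≤ ENNReal.ofReal c * ‖heatKernel n t y‖ₑ := by
  rw [enorm_heatKernel hs, enorm_heatKernel ht, ← ENNReal.ofReal_mul' (heatKernel_pos ht y).le]
  exact ENNReal.ofReal_le_ofReal h

lemma lheatExtension_le_heatMaximal (ht : 0 < t) (g : Rn n → ℝ≥0∞) (x : Rn n) :
    lheatExtension g x t ≤ ENNReal.ofReal (2 ^ ((n : ℝ) / 2)) * heatMaximal g x := by
  obtain ⟨j, hj_lt, hj_le⟩ := exists_mem_Ioc_zpow ht (one_lt_two (α := ℝ))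
  have hj_pos : (0 : ℝ) < 2 ^ (j + 1) := by positivity
  have hratio : (2 : ℝ) ^ (j + 1) / t ≤ 2 := by
    rw [div_le_iff₀ ht, zpow_add_one₀ two_ne_zero]
    linarith
  have hkernel : ∀ y, heatKernel n t (x - y) ≤
      2 ^ ((n : ℝ) / 2) * heatKernel n (2 ^ (j + 1)) (x - y) := fun y =>
    (heatKernel_le_mul ht hj_le _).trans
      (mul_le_mul_of_nonneg_right (by gcongr) (heatKernel_pos hj_pos _).le)
  calc lheatExtension g x t
      ≤ ∫⁻ y, ENNReal.ofReal (2 ^ ((n : ℝ) / 2)) *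
          (‖heatKernel n (2 ^ (j + 1)) (x - y)‖ₑ * g y) := lintegral_mono fun y => by
        rw [← mul_assoc]
        exact mul_le_mul_left (enorm_heatKernel_le_mul ht hj_pos (hkernel y)) _
    _ = ENNReal.ofReal (2 ^ ((n : ℝ) / 2)) * lheatExtension g x (2 ^ (j + 1)) :=
        lintegral_const_mul' _ _ ENNReal.ofReal_ne_top
    _ ≤ _ := mul_le_mul_right (le_iSup (fun j : ℤ => lheatExtension g x (2 ^ j)) (j + 1)) _

lemma mul_measure_lt_heatMaximal_le (hg : Measurable g) (c : ℝ≥0∞) :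
    c * volume {x | c < heatMaximal g x} ≤ 4 ^ n * ∫⁻ y, g y := by
  have hball := mul_measure_setOf_lt_measure_ball (μ := volume) (volume.withDensity g) c
  rw [withDensity_apply _ MeasurableSet.univ, setLIntegral_univ, finrank_euclideanSpace_fin]
    at hball
  refine le_trans ?_ hball
  gcongr with x
  intro hx
  by_contra! hsmall
  refine hx.not_ge (iSup_le fun j => ?_)
  have h := lintegral_enorm_heatKernel_sub_le_of_ball (t := 2 ^ j) (by positivity) x
    (volume.withDensity g) hsmall
  rw [lintegral_withDensity_eq_lintegral_mul _ hg (by fun_prop)] at h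
  simpa only [lheatExtension, Pi.mul_apply, mul_comm] using h

lemma rpow_mul_measure_lt_heatMaximal_le (hb : 1 ≤ b) (hg : Measurable g) (c : ℝ≥0∞) :
    c ^ b * volume {x | c < heatMaximal g x} ≤ 4 ^ n * ∫⁻ y, g y ^ b := by
  refine le_trans (mul_le_mul_right (measure_mono fun x (hx : c < heatMaximal g x) => ?_) _)
    (mul_measure_lt_heatMaximal_le (hg.pow_const b) (c ^ b))
  obtain ⟨j, hj⟩ := lt_iSup_iff.1 hx
  calc c ^ b < lheatExtension g x (2 ^ j) ^ b := ENNReal.rpow_lt_rpow hj (by linarith)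
    _ ≤ lheatExtension (fun y => g y ^ b) x (2 ^ j) :=
        lheatExtension_rpow_le (by positivity) hb hg x
    _ ≤ _ := le_iSup (fun j : ℤ => lheatExtension (fun y => g y ^ b) x (2 ^ j)) j

lemma setLIntegral_heatMaximal_le (hb : 1 < b) (hg : Measurable g)
    (hfin : eLpNorm g (ENNReal.ofReal b) volume ≠ ⊤) (E : Set (Rn n)) :
    ∫⁻ x in E, heatMaximal g x ≤ ENNReal.ofReal (4 ^ ((n : ℝ) / b)) *
      (eLpNorm g (ENNReal.ofReal b) volume + 1) * (volume E + ENNReal.ofReal (b - 1)⁻¹) := by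
  have hb0 : 0 < b := by linarith
  set N := eLpNorm g (ENNReal.ofReal b) volume with hN
  set A : ℝ := 4 ^ ((n : ℝ) / b) * (N.toReal + 1) with hA_def
  have hA : 0 < A := by positivity
  have hA_eq : ENNReal.ofReal A = ENNReal.ofReal (4 ^ ((n : ℝ) / b)) * (N + 1) := by
    rw [hA_def, ENNReal.ofReal_mul (by positivity), ENNReal.ofReal_add (by positivity) one_pos.le,
      ENNReal.ofReal_toReal hfin, ENNReal.ofReal_one]
  have hnorm : 4 ^ n * ∫⁻ y, g y ^ b ≤ ENNReal.ofReal A ^ b := by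
    rw [← eLpNorm_ofReal_rpow hb0, ← hN, hA_eq, ENNReal.mul_rpow_of_nonneg _ _ hb0.le,
      ENNReal.ofReal_rpow_of_pos (by positivity), ← Real.rpow_mul (by norm_num),
      div_mul_cancel₀ _ hb0.ne', Real.rpow_natCast, ENNReal.ofReal_pow (by norm_num),
      ENNReal.ofReal_ofNat]
    gcongr
    exact le_self_add
  have hweak : ∀ c, 0 < c → volume.restrict E {x | ENNReal.ofReal c < heatMaximal g x} ≤
      ENNReal.ofReal ((A / c) ^ b) := fun c hc => by
    rw [Real.div_rpow hA.le hc.le, ENNReal.ofReal_div_of_pos (by positivity),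
      ← ENNReal.ofReal_rpow_of_pos hA, ← ENNReal.ofReal_rpow_of_pos hc,
      ENNReal.le_div_iff_mul_le (Or.inl (ENNReal.rpow_pos (by simpa using hc) (by simp)).ne')
        (Or.inl (ENNReal.rpow_ne_top_of_nonneg hb0.le ENNReal.ofReal_ne_top)), mul_comm]
    exact (mul_le_mul_right (Measure.restrict_apply_le _ _) _).trans
      ((rpow_mul_measure_lt_heatMaximal_le hb.le hg _).trans hnorm)
  rw [← hA_eq]
  simpa only [Measure.restrict_apply_univ] using
    lintegral_le_of_meas_lt_le hA hb
      (measurable_heatMaximal (X := fun x => x) (by fun_prop) measurable_id) hweak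

lemma ae_lintegral_heatMaximal_lt_top {S : Type*} [MeasurableSpace S] {ν : Measure S}
    [IsFiniteMeasure ν] {f : Rn n → S → ℝ≥0∞} (hb : 1 < b)
    (hf : Measurable (Function.uncurry f))
    (hfin : ∫⁻ s, eLpNorm (f · s) (ENNReal.ofReal b) volume ∂ν ≠ ⊤) :
    ∀ᵐ x, ∫⁻ s, heatMaximal (f · s) x ∂ν < ⊤ := by
  have hM : Measurable fun z : Rn n × S => heatMaximal (f · z.2) z.1 :=
    measurable_heatMaximal (hf.comp (by fun_prop : Measurable fun w : (Rn n × S) × Rn n =>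
      (w.2, w.1.2))) measurable_fst
  have hslices : ∀ᵐ s ∂ν, eLpNorm (f · s) (ENNReal.ofReal b) volume ≠ ⊤ :=
    (ae_lt_top (measurable_eLpNorm_slice (by linarith) hf) hfin).mono fun s hs => hs.ne
  refine ae_of_forall_measure_lt_top_ae_restrict _ fun E _ hE => ae_lt_top
    hM.lintegral_prod_right' (ne_of_lt ?_)
  calc ∫⁻ x in E, ∫⁻ s, heatMaximal (f · s) x ∂ν
      = ∫⁻ s, (∫⁻ x in E, heatMaximal (f · s) x) ∂ν := lintegral_lintegral_swap hM.aemeasurable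
    _ ≤ ∫⁻ s, ENNReal.ofReal (4 ^ ((n : ℝ) / b)) *
          (eLpNorm (f · s) (ENNReal.ofReal b) volume + 1) *
            (volume E + ENNReal.ofReal (b - 1)⁻¹) ∂ν :=
        lintegral_mono_ae (hslices.mono fun s hs => setLIntegral_heatMaximal_le hb
          (hf.comp measurable_prodMk_right) hs E)
    _ < ⊤ := by
        rw [lintegral_mul_const' _ _ (by finiteness), lintegral_const_mul' _ _ (by finiteness),
          lintegral_add_right _ measurable_const, lintegral_one]
        finiteness

end HeatMaximal

section InitialTrace

variable {n : ℕ} {s t R : ℝ} {x : Rn n} {U : Rn n → ℝ}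

lemma locallyIntegrable_of_integrable_heatKernel_mul (ht : 0 < t)
    (hint : Integrable fun y => heatKernel n t (x - y) * U y) : LocallyIntegrable U := by
  have hne : ∀ y, heatKernel n t (x - y) ≠ 0 := fun y => (heatKernel_pos ht _).ne'
  have hinv : Continuous fun y => (heatKernel n t (x - y))⁻¹ :=
    ((continuous_heatKernel t).comp (by fun_prop)).inv₀ hne
  have hloc := (hint.locallyIntegrable.locallyIntegrableOn univ).continuousOn_mul
    hinv.continuousOn isOpen_univ.isLocallyClosed
  simpa only [inv_mul_cancel_left₀ (hne _), locallyIntegrableOn_univ] using hloc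

lemma integrable_heatKernel_mul_of_le {c : ℝ} {x' : Rn n} (hs : 0 < s) (ht : 0 < t)
    (h : ∀ y, heatKernel n s (x' - y) ≤ c * heatKernel n t (x - y))
    (hint : Integrable fun y => heatKernel n t (x - y) * U y) :
    Integrable fun y => heatKernel n s (x' - y) * U y := by
  have hU := (locallyIntegrable_of_integrable_heatKernel_mul ht hint).aestronglyMeasurable
  have hK : Measurable fun y => heatKernel n s (x' - y) := by fun_prop
  refine (hint.norm.const_mul c).mono' (hK.aestronglyMeasurable.mul hU) (ae_of_all _ fun y => ?_)
  rw [norm_mul, norm_mul, ← mul_assoc, Real.norm_of_nonneg (heatKernel_pos hs _).le,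
    Real.norm_of_nonneg (heatKernel_pos ht _).le]
  exact mul_le_mul_of_nonneg_right (h y) (norm_nonneg _)

lemma integrable_heatKernel_mul_of_time_le (hs : 0 < s) (hst : s ≤ t)
    (hint : Integrable fun y => heatKernel n t (x - y) * U y) :
    Integrable fun y => heatKernel n s (x - y) * U y :=
  integrable_heatKernel_mul_of_le hs (hs.trans_le hst) (fun _ => heatKernel_le_mul hs hst _) hint

lemma integrable_heatKernel_mul_of_integrable_two_mul {x₀ : Rn n} (ht : 0 < t)
    (hint : Integrable fun y => heatKernel n (2 * t) (x₀ - y) * U y) (x : Rn n) :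
    Integrable fun y => heatKernel n t (x - y) * U y := by
  refine integrable_heatKernel_mul_of_le (x := x₀)
    (c := 2 ^ ((n : ℝ) / 2) * Real.exp (‖x₀ - x‖ ^ 2 / (4 * t))) ht (by positivity)
    (fun y => ?_) hint
  have h := heatKernel_add_le_mul ht (x - y) (x₀ - x)
  rwa [show x - y + (x₀ - x) = x₀ - y by abel] at h

lemma enorm_heatExtension_sub_le (ht : 0 < t)
    (hint : Integrable fun y => heatKernel n t (x - y) * U y) (a : ℝ) :
    ‖heatExtension U x t - a‖ₑ ≤ lheatExtension (fun y => ‖U y - a‖ₑ) x t := by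
  have hdiff : heatExtension U x t - a = ∫ y, heatKernel n t (x - y) * (U y - a) := by
    simp_rw [mul_sub]
    rw [integral_sub hint (((integrable_heatKernel ht).comp_sub_left x).mul_const _),
      integral_mul_const, integral_sub_left_eq_self (heatKernel n t), integral_heatKernel ht,
      one_mul, heatExtension]
  rw [hdiff]
  refine (enorm_integral_le_lintegral_enorm _).trans_eq ?_
  simp only [enorm_mul, lheatExtension]

lemma setLIntegral_ball_heatKernel_mul_le {g : Rn n → ℝ≥0∞} {A : ℝ≥0∞} (ht : 0 < t)
    (hg : AEMeasurable g) (hR : 0 < R) (hball : ∀ r ∈ Ioc 0 R,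
      ∫⁻ y in Metric.ball x r, g y ≤ A * volume (Metric.ball x r)) :
    ∫⁻ y in Metric.ball x R, ‖heatKernel n t (x - y)‖ₑ * g y ≤ A := by
  have hK : Measurable fun y => ‖heatKernel n t (x - y)‖ₑ := by fun_prop
  have h := lintegral_enorm_heatKernel_sub_le_of_ball ht x
    ((volume.restrict (Metric.ball x R)).withDensity g) (A := A) fun r hr => by
      have hinter : Metric.ball x r ∩ Metric.ball x R = Metric.ball x (min r R) := by
        ext y
        simp only [mem_inter_iff, Metric.mem_ball, lt_min_iff]
      rw [withDensity_apply _ measurableSet_ball, Measure.restrict_restrict measurableSet_ball,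
        hinter]
      refine (hball _ ⟨lt_min hr hR, min_le_right _ _⟩).trans ?_
      gcongr
      exact min_le_left _ _
  rw [lintegral_withDensity_eq_lintegral_mul₀ hg.restrict hK.aemeasurable] at h
  simpa only [Pi.mul_apply, mul_comm] using h

lemma setLIntegral_ball_compl_heatKernel_mul_le (hs : 0 < s) (hst : s ≤ t) (hR : 0 ≤ R)
    (g : Rn n → ℝ≥0∞) :
    ∫⁻ y in (Metric.ball x R)ᶜ, ‖heatKernel n s (x - y)‖ₑ * g y ≤
      ENNReal.ofReal ((t / s) ^ ((n : ℝ) / 2) *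
        Real.exp (-R ^ 2 * (1 / (4 * s) - 1 / (4 * t)))) * lheatExtension g x t := by
  rw [lheatExtension, ← lintegral_const_mul' _ _ ENNReal.ofReal_ne_top]
  refine (setLIntegral_mono' measurableSet_ball.compl fun y hy => ?_).trans
    (setLIntegral_le_lintegral _ _)
  have hy_norm : R ≤ ‖x - y‖ := by
    simpa only [mem_compl_iff, Metric.mem_ball, not_lt, dist_comm y, dist_eq_norm] using hy
  rw [← mul_assoc]
  exact mul_le_mul_left (enorm_heatKernel_le_mul hs (hs.trans_le hst)
    (heatKernel_le_mul_of_le_norm hs hst hR hy_norm)) _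

lemma tendsto_lheatExtension_zero {g : Rn n → ℝ≥0∞} (ht : 0 < t) (hg : AEMeasurable g)
    (hfin : lheatExtension g x t ≠ ⊤) (hball : ∀ ε : ℝ≥0∞, ε ≠ 0 → ∃ R > 0, ∀ r ∈ Ioc 0 R,
      ∫⁻ y in Metric.ball x r, g y ≤ ε * volume (Metric.ball x r)) :
    Tendsto (lheatExtension g x) (𝓝[>] 0) (𝓝 0) := by
  rw [ENNReal.tendsto_nhds_zero]
  intro ε hε
  have hε_half : ε / 2 ≠ 0 := (ENNReal.half_pos hε.ne').ne'
  obtain ⟨R, hR, hnear⟩ := hball (ε / 2) hε_half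
  have htail := ENNReal.Tendsto.mul_const
    (ENNReal.tendsto_ofReal (tendsto_heatKernel_tail_factor n ht hR)) (Or.inr hfin)
  rw [ENNReal.ofReal_zero, zero_mul] at htail
  filter_upwards [htail.eventually (ge_mem_nhds (pos_iff_ne_zero.2 hε_half)),
    Ioc_mem_nhdsGT ht] with s hs_tail hs
  rw [lheatExtension, ← lintegral_add_compl _ (measurableSet_ball (x := x) (ε := R)),
    ← ENNReal.add_halves ε]
  exact add_le_add (setLIntegral_ball_heatKernel_mul_le hs.1 hg hR hnear)
    ((setLIntegral_ball_compl_heatKernel_mul_le hs.1 hs.2 hR.le g).trans hs_tail)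

lemma ae_tendsto_heatExtension (ht : 0 < t)
    (hint : ∀ᵐ x, Integrable fun y => heatKernel n t (x - y) * U y) :
    ∀ᵐ x, Tendsto (heatExtension U x) (𝓝[>] 0) (𝓝 (U x)) := by
  obtain ⟨x₀, hx₀⟩ := hint.exists
  have hU := locallyIntegrable_of_integrable_heatKernel_mul ht hx₀
  filter_upwards [hint, ae_exists_setLIntegral_ball_enorm_sub_le hU] with x hx hball
  have hfin : lheatExtension (fun y => ‖U y - U x‖ₑ) x t ≠ ⊤ := by
    have hdiff : Integrable fun y => heatKernel n t (x - y) * (U y - U x) := by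
      simp_rw [mul_sub]
      exact hx.sub (((integrable_heatKernel ht).comp_sub_left x).mul_const _)
    simpa only [lheatExtension, ← enorm_mul] using hdiff.hasFiniteIntegral.ne
  have hlim := tendsto_lheatExtension_zero ht
    (hU.aestronglyMeasurable.sub aestronglyMeasurable_const).enorm hfin hball
  rw [tendsto_iff_edist_tendsto_0]
  refine tendsto_of_tendsto_of_tendsto_of_le_of_le' tendsto_const_nhds hlim
    (Eventually.of_forall fun _ => zero_le) ?_
  filter_upwards [Ioc_mem_nhdsGT ht] with s hs
  rw [edist_eq_enorm_sub]
  exact enorm_heatExtension_sub_le hs.1 (integrable_heatKernel_mul_of_time_le hs.1 hs.2 hx) _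

end InitialTrace

section Duhamel

variable {n : ℕ} {f g : Rn n → ℝ → ℝ≥0∞}

/-- The Duhamel integral `∫₀ᵗ e^{(t-s)Δ} f(·, s) ds` of a `[0, ∞]`-valued source, defined without
integrability assumptions. -/
noncomputable def heatDuhamel (f : Rn n → ℝ → ℝ≥0∞) (x : Rn n) (t : ℝ) : ℝ≥0∞ :=
  ∫⁻ s in Ioo 0 t, lheatExtension (f · s) x (t - s)

lemma measurable_lheatExtension_slice {A : Type*} [MeasurableSpace A] {X : A → Rn n} {S τ : A → ℝ}
    (hf : Measurable (Function.uncurry f)) (hX : Measurable X) (hS : Measurable S)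
    (hτ : Measurable τ) : Measurable fun a => lheatExtension (f · (S a)) (X a) (τ a) :=
  measurable_lheatExtension
    (hf.comp (by fun_prop : Measurable fun v : A × Rn n => (v.2, S v.1))) hX hτ

lemma measurable_heatDuhamel (hf : Measurable (Function.uncurry f)) :
    Measurable (Function.uncurry (heatDuhamel f)) := by
  have hlt : MeasurableSet {w : (Rn n × ℝ) × ℝ | 0 < w.2 ∧ w.2 < w.1.2} :=
    (measurableSet_lt measurable_const measurable_snd).inter
      (measurableSet_lt measurable_snd measurable_fst.snd)
  have hheat : Measurable fun w : (Rn n × ℝ) × ℝ =>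
      lheatExtension (f · w.2) w.1.1 (w.1.2 - w.2) :=
    measurable_lheatExtension_slice hf measurable_fst.fst measurable_snd (by fun_prop)
  convert (hheat.indicator hlt).lintegral_prod_right' (ν := volume) using 2 with z
  exact (lintegral_indicator measurableSet_Ioo _).symm

lemma heatDuhamel_mono (h : ∀ x s, f x s ≤ g x s) (x : Rn n) (t : ℝ) :
    heatDuhamel f x t ≤ heatDuhamel g x t :=
  lintegral_mono fun s => lheatExtension_mono (h · s) x (t - s)

lemma heatDuhamel_congr_ae {T t : ℝ} (htT : t ≤ T)
    (h : ∀ᵐ z ∂(volume.prod (volume.restrict (Ioo 0 T))), f z.1 z.2 = g z.1 z.2) (x : Rn n) :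
    heatDuhamel f x t = heatDuhamel g x t := by
  refine lintegral_congr_ae ?_
  filter_upwards [ae_restrict_of_ae_restrict_of_subset (Ioo_subset_Ioo_right htT)
    (ae_ae_of_ae_prod_swap h)] with s hs
  exact lintegral_congr_ae (hs.mono fun y hy => congrArg (_ * ·) hy)

lemma heatDuhamel_const_mul {c : ℝ≥0∞} (hc : c ≠ ⊤) (f : Rn n → ℝ → ℝ≥0∞) (x : Rn n) (t : ℝ) :
    heatDuhamel (fun y s => c * f y s) x t = c * heatDuhamel f x t := by
  simp only [heatDuhamel, lheatExtension, mul_left_comm _ c, lintegral_const_mul' c _ hc]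

lemma heatDuhamel_iSup {f : ℕ → Rn n → ℝ → ℝ≥0∞} (hf : ∀ j, Measurable (Function.uncurry (f j)))
    (hmono : ∀ x t, Monotone fun j => f j x t) (x : Rn n) (t : ℝ) :
    heatDuhamel (fun y s => ⨆ j, f j y s) x t = ⨆ j, heatDuhamel (f j) x t := by
  have hslice : ∀ s, lheatExtension (fun y => ⨆ j, f j y s) x (t - s) =
      ⨆ j, lheatExtension (f j · s) x (t - s) := fun s => by
    simp_rw [lheatExtension, ENNReal.mul_iSup]
    refine lintegral_iSup (fun j => ?_) fun i j hij y => mul_le_mul_right (hmono y s hij) _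
    exact Measurable.mul (by fun_prop) ((hf j).comp measurable_prodMk_right)
  simp only [heatDuhamel, hslice]
  exact lintegral_iSup
    (fun j => measurable_lheatExtension_slice (X := fun _ => x) (S := fun s => s) (hf j)
      measurable_const measurable_id (by fun_prop))
    fun i j hij s => lheatExtension_mono (fun y => hmono y s hij) x (t - s)

lemma heatDuhamel_le_heatMaximal (f : Rn n → ℝ → ℝ≥0∞) (x : Rn n) (t : ℝ) :
    heatDuhamel f x t ≤ ENNReal.ofReal (2 ^ ((n : ℝ) / 2)) *
      ∫⁻ s in Ioo 0 t, heatMaximal (f · s) x := by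
  rw [← lintegral_const_mul' _ _ ENNReal.ofReal_ne_top]
  exact setLIntegral_mono' measurableSet_Ioo fun s hs =>
    lheatExtension_le_heatMaximal (sub_pos.2 hs.2) _ x

lemma heatDuhamel_lt_top_of_lintegral_heatMaximal {T t : ℝ} {x : Rn n} (htT : t ≤ T)
    (hfin : ∫⁻ s in Ioo 0 T, heatMaximal (f · s) x < ⊤) : heatDuhamel f x t < ⊤ :=
  (heatDuhamel_le_heatMaximal f x t).trans_lt (ENNReal.mul_lt_top ENNReal.ofReal_lt_top
    ((lintegral_mono_set (Ioo_subset_Ioo_right htT)).trans_lt hfin))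

lemma tendsto_heatDuhamel_zero {T : ℝ} {x : Rn n} (hT : 0 < T)
    (hfin : ∫⁻ s in Ioo 0 T, heatMaximal (f · s) x < ⊤) :
    Tendsto (heatDuhamel f x) (𝓝[>] 0) (𝓝 0) := by
  have hlim := ENNReal.Tendsto.const_mul (a := ENNReal.ofReal (2 ^ ((n : ℝ) / 2)))
    (tendsto_setLIntegral_Ioo_zero hT hfin) (Or.inr ENNReal.ofReal_ne_top)
  rw [mul_zero] at hlim
  exact tendsto_of_tendsto_of_tendsto_of_le_of_le tendsto_const_nhds hlim
    (fun _ => zero_le) (heatDuhamel_le_heatMaximal f x)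

end Duhamel

section MixedNorm

variable {n : ℕ} {p q k T : ℝ}

/-- The `q`-th power of the norm of `L^q((0, T), t^k dt; L^p(ℝⁿ))`. -/
noncomputable def mixedNormPow {ε : Type*} [ENorm ε] (p q k T : ℝ) (F : Rn n → ℝ → ε) : ℝ≥0∞ :=
  ∫⁻ t in Ioo 0 T, eLpNorm (F · t) (ENNReal.ofReal p) volume ^ q * ENNReal.ofReal (t ^ k)

lemma mixedNormPow_mono_time {ε : Type*} [ENorm ε] {T' : ℝ} (h : T ≤ T') (F : Rn n → ℝ → ε) :
    mixedNormPow p q k T F ≤ mixedNormPow p q k T' F :=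
  lintegral_mono_set (Ioo_subset_Ioo_right h)

lemma mixedNormPow_mono_enorm {ε ε' : Type*} [ENorm ε] [ENorm ε'] {F : Rn n → ℝ → ε}
    {G : Rn n → ℝ → ε'} (hq : 0 ≤ q) (h : ∀ x t, ‖F x t‖ₑ ≤ ‖G x t‖ₑ) :
    mixedNormPow p q k T F ≤ mixedNormPow p q k T G := by
  refine lintegral_mono fun t => ?_
  gcongr
  exact eLpNorm_mono_enorm fun x => h x t

lemma mixedNormPow_congr_enorm_ae {ε ε' : Type*} [ENorm ε] [ENorm ε'] {F : Rn n → ℝ → ε}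
    {G : Rn n → ℝ → ε'}
    (h : ∀ᵐ z ∂(volume.prod (volume.restrict (Ioo 0 T))), ‖F z.1 z.2‖ₑ = ‖G z.1 z.2‖ₑ) :
    mixedNormPow p q k T F = mixedNormPow p q k T G :=
  lintegral_congr_ae ((ae_ae_of_ae_prod_swap h).mono fun s hs => by
    simp only [eLpNorm_congr_enorm_ae hs])

variable {F G : Rn n → ℝ → ℝ≥0∞}

lemma mixedNormPow_zero (hq : 0 < q) :
    mixedNormPow p q k T (fun (_ : Rn n) _ => (0 : ℝ≥0∞)) = 0 := by
  simp only [mixedNormPow, eLpNorm_zero', ENNReal.zero_rpow_of_pos hq, zero_mul, lintegral_zero]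

lemma mixedNormPow_add_le (hp : 1 ≤ p) (hq : 1 ≤ q) (hF : Measurable (Function.uncurry F))
    (hG : Measurable (Function.uncurry G)) :
    mixedNormPow p q k T (fun x t => F x t + G x t) ≤
      2 ^ (q - 1) * (mixedNormPow p q k T F + mixedNormPow p q k T G) := by
  have hmeas : Measurable fun t =>
      eLpNorm (F · t) (ENNReal.ofReal p) volume ^ q * ENNReal.ofReal (t ^ k) :=
    ((measurable_eLpNorm_slice (by linarith) hF).pow_const q).mul (by fun_prop)
  unfold mixedNormPow
  rw [← lintegral_add_left hmeas, ← lintegral_const_mul' _ _ (by finiteness)]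
  refine lintegral_mono fun t => ?_
  rw [← add_mul, ← mul_assoc]
  gcongr
  refine le_trans ?_ (ENNReal.rpow_add_le_mul_rpow_add_rpow _ _ hq)
  gcongr
  exact eLpNorm_add_le (hF.comp measurable_prodMk_right).aestronglyMeasurable
    (hG.comp measurable_prodMk_right).aestronglyMeasurable (by simpa using hp)

lemma mixedNormPow_iSup (hp : 0 < p) (hq : 0 < q) {F : ℕ → Rn n → ℝ → ℝ≥0∞}
    (hF : ∀ j, Measurable (Function.uncurry (F j))) (hmono : ∀ x t, Monotone fun j => F j x t) :
    mixedNormPow p q k T (fun x t => ⨆ j, F j x t) = ⨆ j, mixedNormPow p q k T (F j) := by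
  have hslice : ∀ t, eLpNorm (fun x => ⨆ j, F j x t) (ENNReal.ofReal p) volume ^ q =
      ⨆ j, eLpNorm (F j · t) (ENNReal.ofReal p) volume ^ q := fun t => by
    rw [eLpNorm_ofReal_iSup (f := fun j => (F j · t)) hp
      (fun j => (hF j).comp measurable_prodMk_right) (hmono · t), ennreal_iSup_rpow hq]
  simp_rw [mixedNormPow, hslice, ENNReal.iSup_mul]
  refine lintegral_iSup
    (fun j => ((measurable_eLpNorm_slice hp (hF j)).pow_const q).mul (by fun_prop))
    fun i j hij t => ?_
  simp only
  gcongr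
  exact eLpNorm_mono_enorm fun x => hmono x t hij

end MixedNorm

section Estimates

variable {n : ℕ} {α p q k : ℝ}

lemma eLpNorm_rpow_ofReal_div {X : Type*} [MeasurableSpace X] {μ : Measure X} (hα : 0 < α)
    (hp : 0 < p) (g : X → ℝ≥0∞) : eLpNorm (fun x => g x ^ α) (ENNReal.ofReal (p / α)) μ =
      eLpNorm g (ENNReal.ofReal p) μ ^ α := by
  rw [eLpNorm_ofReal_eq_lintegral_rpow (by positivity), eLpNorm_ofReal_eq_lintegral_rpow hp,
    ← ENNReal.rpow_mul, one_div_div, one_div_mul_eq_div]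
  simp only [← ENNReal.rpow_mul, mul_div_cancel₀ p hα.ne']

lemma eLpNorm_lheatExtension_rpow_le {t : ℝ} (ht : 0 < t) (hα : 1 ≤ α) (hαp : α ≤ p)
    {g : Rn n → ℝ≥0∞} (hg : Measurable g) :
    eLpNorm (lheatExtension (fun y => g y ^ α) · t) (ENNReal.ofReal p) volume ≤
      ENNReal.ofReal (t ^ (-((n : ℝ) / 2 * ((α - 1) / p)))) *
        eLpNorm g (ENNReal.ofReal p) volume ^ α := by
  have hα0 : 0 < α := by linarith
  have hp : 0 < p := by linarith
  have hγ : 0 ≤ (n : ℝ) / 2 * ((α - 1) / p) :=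
    mul_nonneg (by positivity) (div_nonneg (by linarith) hp.le)
  have htime : t ≤ 4 * Real.pi * t := le_mul_of_one_le_left ht.le (by linarith [Real.pi_gt_three])
  rw [← eLpNorm_rpow_ofReal_div hα0 hp]
  refine (eLpNorm_lheatExtension_le ht ((one_le_div hα0).2 hαp) (div_le_self hp.le hα)
    (hg.pow_const α)).trans ?_
  gcongr
  calc (4 * Real.pi * t) ^ (-(n : ℝ) / 2 * (1 / (p / α) - 1 / p))
      = (4 * Real.pi * t) ^ (-((n : ℝ) / 2 * ((α - 1) / p))) := by
        congr 1
        field_simp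
    _ ≤ t ^ (-((n : ℝ) / 2 * ((α - 1) / p))) :=
        Real.rpow_le_rpow_of_nonpos ht htime (neg_nonpos.2 hγ)

lemma eLpNorm_heatDuhamel_rpow_le {t : ℝ} (ht : 0 < t) (hα : 1 ≤ α) (hαp : α ≤ p) (hαq : α < q)
    (hκ : k * α / (q - α) < 1) (hβ : (n : ℝ) / 2 * ((α - 1) / p) * (q / (q - α)) < 1)
    {F : Rn n → ℝ → ℝ≥0∞} (hF : Measurable (Function.uncurry F)) :
    eLpNorm (heatDuhamel (fun y s => F y s ^ α) · t) (ENNReal.ofReal p) volume ≤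
      ENNReal.ofReal (ProbabilityTheory.beta (1 - k * α / (q - α))
          (1 - (n : ℝ) / 2 * ((α - 1) / p) * (q / (q - α))) *
        t ^ (1 - (n : ℝ) / 2 * ((α - 1) / p) * (q / (q - α)) - k * α / (q - α))) ^ ((q - α) / q) *
      mixedNormPow p q k t F ^ (α / q) := by
  have hp : 0 < p := by linarith
  have hslice : Measurable (Function.uncurry fun (x : Rn n) s =>
      lheatExtension (fun y => F y s ^ α) x (t - s)) :=
    measurable_lheatExtension_slice (f := fun y s => F y s ^ α) (hF.pow_const α) measurable_fst
      measurable_snd (by fun_prop)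
  calc eLpNorm (heatDuhamel (fun y s => F y s ^ α) · t) (ENNReal.ofReal p) volume
      ≤ ∫⁻ s in Ioo 0 t, eLpNorm (lheatExtension (fun y => F y s ^ α) · (t - s))
          (ENNReal.ofReal p) volume := eLpNorm_lintegral_le (hα.trans hαp) hslice
    _ ≤ ∫⁻ s in Ioo 0 t, ENNReal.ofReal ((t - s) ^ (-((n : ℝ) / 2 * ((α - 1) / p)))) *
          eLpNorm (F · s) (ENNReal.ofReal p) volume ^ α :=
        setLIntegral_mono' measurableSet_Ioo fun s hs => eLpNorm_lheatExtension_rpow_le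
          (sub_pos.2 hs.2) hα hαp (hF.comp measurable_prodMk_right)
    _ ≤ _ := setLIntegral_sub_rpow_mul_rpow_le (by linarith) hαq hκ hβ ht
        (measurable_eLpNorm_slice hp hF)

lemma exists_tendsto_zero_mixedNormPow_heatDuhamel_rpow_le (hα : 1 ≤ α) (hαp : α ≤ p) (hαq : α < q)
    (hκ : k * α / (q - α) < 1) (hβ : (n : ℝ) / 2 * ((α - 1) / p) * (q / (q - α)) < 1)
    (hexp : -1 < k + (q - α) *
      (1 - (n : ℝ) / 2 * ((α - 1) / p) * (q / (q - α)) - k * α / (q - α))) :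
    ∃ C : ℝ → ℝ≥0∞, Tendsto C (𝓝[>] 0) (𝓝 0) ∧ ∀ (T : ℝ) (F : Rn n → ℝ → ℝ≥0∞),
      Measurable (Function.uncurry F) →
        mixedNormPow p q k T (heatDuhamel fun y s => F y s ^ α) ≤
          C T * mixedNormPow p q k T F ^ α := by
  have hq : 0 < q := by linarith
  set e := 1 - (n : ℝ) / 2 * ((α - 1) / p) * (q / (q - α)) - k * α / (q - α)
  set B := ProbabilityTheory.beta (1 - k * α / (q - α))
    (1 - (n : ℝ) / 2 * ((α - 1) / p) * (q / (q - α)))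
  have hmeas : Measurable fun t =>
      ENNReal.ofReal (B * t ^ e) ^ (q - α) * ENNReal.ofReal (t ^ k) := by fun_prop
  refine ⟨fun T => ∫⁻ t in Ioo 0 T, ENNReal.ofReal (B * t ^ e) ^ (q - α) * ENNReal.ofReal (t ^ k),
    tendsto_setLIntegral_Ioo_zero one_pos
      (setLIntegral_mul_rpow_rpow_lt_top (by linarith) hexp one_pos B), fun T F hF => ?_⟩
  rw [← lintegral_mul_const _ hmeas]
  refine setLIntegral_mono' measurableSet_Ioo fun t ⟨ht, htT⟩ => ?_
  have hslice : eLpNorm (heatDuhamel (fun y s => F y s ^ α) · t) (ENNReal.ofReal p) volume ^ q ≤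
      ENNReal.ofReal (B * t ^ e) ^ (q - α) * mixedNormPow p q k T F ^ α := by
    refine (ENNReal.rpow_le_rpow (eLpNorm_heatDuhamel_rpow_le ht hα hαp hαq hκ hβ hF)
      hq.le).trans ?_
    rw [ENNReal.mul_rpow_of_nonneg _ _ hq.le, ← ENNReal.rpow_mul, ← ENNReal.rpow_mul,
      div_mul_cancel₀ _ hq.ne', div_mul_cancel₀ _ hq.ne']
    gcongr
    exact mixedNormPow_mono_time htT.le F
  rw [mul_right_comm]
  gcongr

lemma lintegral_eLpNorm_rpow_lt_top (hα : 0 < α) (hp : 0 < p) (hαq : α < q)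
    (hκ : k * α / (q - α) < 1) {T : ℝ} (hT : 0 < T)
    {F : Rn n → ℝ → ℝ≥0∞} (hF : Measurable (Function.uncurry F))
    (hfin : mixedNormPow p q k T F < ⊤) :
    ∫⁻ s in Ioo 0 T, eLpNorm (F · s) (ENNReal.ofReal p) volume ^ α < ⊤ := by
  have hq : 0 < q := by linarith
  have : 0 < q - α := by linarith
  have h := setLIntegral_sub_rpow_mul_rpow_le (γ := 0) hα hαq hκ (by simp) hT
    (measurable_eLpNorm_slice (μ := volume) hp hF)
  simp only [neg_zero, Real.rpow_zero, ENNReal.ofReal_one, one_mul] at h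
  exact h.trans_lt (ENNReal.mul_lt_top (ENNReal.rpow_lt_top_of_nonneg (by positivity)
    ENNReal.ofReal_ne_top) (ENNReal.rpow_lt_top_of_nonneg (by positivity) hfin.ne))

lemma ae_lintegral_heatMaximal_rpow_lt_top (hα : 0 < α) (hαp : α < p) (hαq : α < q)
    (hκ : k * α / (q - α) < 1) {T : ℝ} (hT : 0 < T) {F : Rn n → ℝ → ℝ≥0∞}
    (hF : Measurable (Function.uncurry F)) (hfin : mixedNormPow p q k T F < ⊤) :
    ∀ᵐ x, ∫⁻ s in Ioo 0 T, heatMaximal (fun y => F y s ^ α) x < ⊤ := by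
  have hp : 0 < p := by linarith
  refine ae_lintegral_heatMaximal_lt_top (ν := volume.restrict (Ioo 0 T))
    ((one_lt_div hα).2 hαp) (hF.pow_const α) ?_
  simp only [eLpNorm_rpow_ofReal_div hα hp]
  exact (lintegral_eLpNorm_rpow_lt_top hα hp hαq hκ hT hF hfin).ne

end Estimates

section Picard

variable {n : ℕ} {H : Rn n → ℝ → ℝ≥0∞} {G : Rn n → ℝ → ℝ≥0∞ → ℝ≥0∞}

/-- Picard iteration, started at `0`, for the integral equation
`z(·, t) = H(·, t) + ∫₀ᵗ e^{(t-s)Δ} G(z)(·, s) ds` in `[0, ∞]`. The nonlinearity `G` may depend on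
space and time. -/
noncomputable def heatPicard (H : Rn n → ℝ → ℝ≥0∞) (G : Rn n → ℝ → ℝ≥0∞ → ℝ≥0∞) :
    ℕ → Rn n → ℝ → ℝ≥0∞
  | 0 => fun _ _ => 0
  | j + 1 => fun x t => H x t + heatDuhamel (fun y s => G y s (heatPicard H G j y s)) x t

lemma measurable_heatPicard (hH : Measurable (Function.uncurry H))
    (hG : Measurable fun z : (Rn n × ℝ) × ℝ≥0∞ => G z.1.1 z.1.2 z.2) (j : ℕ) :
    Measurable (Function.uncurry (heatPicard H G j)) := by
  induction j with
  | zero => exact measurable_const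
  | succ j ih =>
    exact hH.add (measurable_heatDuhamel (f := fun y s => G y s (heatPicard H G j y s))
      (hG.comp (measurable_id.prodMk ih)))

lemma monotone_heatPicard (hmono : ∀ y s, Monotone (G y s)) (x : Rn n) (t : ℝ) :
    Monotone fun j => heatPicard H G j x t := by
  suffices h : ∀ j x t, heatPicard H G j x t ≤ heatPicard H G (j + 1) x t from
    monotone_nat_of_le_succ fun j => h j x t
  intro j
  induction j with
  | zero => exact fun x t => zero_le
  | succ j ih =>
    exact fun x t => add_le_add_right (heatDuhamel_mono (fun y s => hmono y s (ih y s)) x t) _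

lemma heatPicard_le_of_supersolution (hmono : ∀ y s, Monotone (G y s)) {Z : Rn n → ℝ → ℝ≥0∞}
    (hZ : ∀ x t, H x t + heatDuhamel (fun y s => G y s (Z y s)) x t ≤ Z x t) (j : ℕ) (x : Rn n)
    (t : ℝ) : heatPicard H G j x t ≤ Z x t := by
  induction j generalizing x t with
  | zero => exact zero_le
  | succ j ih =>
    exact (add_le_add_right (heatDuhamel_mono (fun y s => hmono y s (ih y s)) x t) _).trans (hZ x t)

lemma iSup_heatPicard_eq (hH : Measurable (Function.uncurry H))
    (hG : Measurable fun z : (Rn n × ℝ) × ℝ≥0∞ => G z.1.1 z.1.2 z.2)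
    (hmono : ∀ y s, Monotone (G y s)) {T t : ℝ} (htT : t ≤ T)
    (hcont : ∀ᵐ z ∂(volume.prod (volume.restrict (Ioo 0 T))),
      ∀ a : ℕ → ℝ≥0∞, Monotone a → ⨆ j, G z.1 z.2 (a j) = G z.1 z.2 (⨆ j, a j)) (x : Rn n) :
    ⨆ j, heatPicard H G j x t =
      H x t + heatDuhamel (fun y s => G y s (⨆ j, heatPicard H G j y s)) x t := by
  have hmeas := measurable_heatPicard hH hG
  have hiter := monotone_heatPicard (H := H) hmono
  calc ⨆ j, heatPicard H G j x t
      = ⨆ j, (H x t + heatDuhamel (fun y s => G y s (heatPicard H G j y s)) x t) :=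
        ((hiter x t).iSup_nat_add 1).symm
    _ = H x t + heatDuhamel (fun y s => ⨆ j, G y s (heatPicard H G j y s)) x t := by
        rw [← ENNReal.add_iSup, heatDuhamel_iSup
          (f := fun j y s => G y s (heatPicard H G j y s))
          (fun j => hG.comp (measurable_id.prodMk (hmeas j)))
          (fun y s i j hij => hmono y s (hiter y s hij))]
    _ = _ := congrArg (H x t + ·)
        (heatDuhamel_congr_ae htT (hcont.mono fun z hz => hz _ (hiter z.1 z.2)) x)

end Picard

section Majorant

variable {n : ℕ} {α p q k T : ℝ} {h : Rn n → ℝ → ℝ≥0∞} {C M : ℝ≥0∞}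

lemma mixedNormPow_heatPicard_rpow_le (hα : 0 ≤ α) (hp : 1 ≤ p) (hq : 1 ≤ q)
    (hh : Measurable (Function.uncurry h))
    (hC : ∀ F : Rn n → ℝ → ℝ≥0∞, Measurable (Function.uncurry F) →
      mixedNormPow p q k T (heatDuhamel fun y s => F y s ^ α) ≤ C * mixedNormPow p q k T F ^ α)
    (hM : 2 ^ (q - 1) * (mixedNormPow p q k T h + C * M ^ α) ≤ M) (j : ℕ) :
    mixedNormPow p q k T (heatPicard h (fun _ _ r => r ^ α) j) ≤ M := by
  have hmeas := measurable_heatPicard (G := fun _ _ r => r ^ α) hh (by fun_prop)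
  induction j with
  | zero => exact (mixedNormPow_zero (by linarith)).trans_le zero_le
  | succ j ih =>
    calc mixedNormPow p q k T (heatPicard h (fun _ _ r => r ^ α) (j + 1))
        ≤ 2 ^ (q - 1) * (mixedNormPow p q k T h + mixedNormPow p q k T
            (heatDuhamel fun y s => heatPicard h (fun _ _ r => r ^ α) j y s ^ α)) :=
          mixedNormPow_add_le hp hq hh (measurable_heatDuhamel
            (f := fun y s => heatPicard h (fun _ _ r => r ^ α) j y s ^ α) ((hmeas j).pow_const α))
      _ ≤ 2 ^ (q - 1) * (mixedNormPow p q k T h + C * M ^ α) := by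
          gcongr
          exact (hC _ (hmeas j)).trans (by gcongr)
      _ ≤ M := hM

lemma exists_eq_add_heatDuhamel_rpow (hα : 1 ≤ α) (hαp : α ≤ p) (hαq : α < q)
    (hκ : k * α / (q - α) < 1) (hβ : (n : ℝ) / 2 * ((α - 1) / p) * (q / (q - α)) < 1)
    (hexp : -1 < k + (q - α) *
      (1 - (n : ℝ) / 2 * ((α - 1) / p) * (q / (q - α)) - k * α / (q - α)))
    {T₀ : ℝ} (hT₀ : 0 < T₀) (hh : Measurable (Function.uncurry h))
    (hfin : mixedNormPow p q k T₀ h < ⊤) :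
    ∃ T ∈ Ioc 0 T₀, ∃ w : Rn n → ℝ → ℝ≥0∞, Measurable (Function.uncurry w) ∧
      mixedNormPow p q k T w < ⊤ ∧
      ∀ x t, w x t = h x t + heatDuhamel (fun y s => w y s ^ α) x t := by
  have hα0 : 0 < α := by linarith
  have hp1 : 1 ≤ p := hα.trans hαp
  have hq1 : 1 ≤ q := hα.trans hαq.le
  obtain ⟨C, hC_lim, hC⟩ :=
    exists_tendsto_zero_mixedNormPow_heatDuhamel_rpow_le hα hαp hαq hκ hβ hexp
  set D : ℝ≥0∞ := 2 ^ (q - 1)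
  have hD : D ≠ ⊤ := by finiteness
  set M := D * mixedNormPow p q k T₀ h + 1
  have hM : M < ⊤ := by finiteness
  have hsmall : Tendsto (fun T => D * (C T * M ^ α)) (𝓝[>] 0) (𝓝 0) := by
    have hlim := ENNReal.Tendsto.const_mul (a := D)
      (ENNReal.Tendsto.mul_const hC_lim (Or.inr (show M ^ α ≠ ⊤ by finiteness))) (Or.inr hD)
    rwa [zero_mul, mul_zero] at hlim
  obtain ⟨T, hT_small, hT⟩ := ((hsmall.eventually (ge_mem_nhds zero_lt_one)).and
    (Ioc_mem_nhdsGT hT₀)).exists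
  have hinvariant : D * (mixedNormPow p q k T h + C T * M ^ α) ≤ M := by
    rw [mul_add]
    exact add_le_add (mul_le_mul_right (mixedNormPow_mono_time hT.2 h) _) hT_small
  have hmono : ∀ (_ : Rn n) (_ : ℝ), Monotone fun r : ℝ≥0∞ => r ^ α :=
    fun _ _ => ENNReal.monotone_rpow_of_nonneg hα0.le
  have hmeas := measurable_heatPicard (G := fun _ _ r => r ^ α) hh (by fun_prop)
  refine ⟨T, hT, fun x t => ⨆ j, heatPicard h (fun _ _ r => r ^ α) j x t, Measurable.iSup hmeas,
    ?_, fun x t => ?_⟩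
  · rw [mixedNormPow_iSup (by linarith) (by linarith) hmeas (monotone_heatPicard hmono)]
    exact (iSup_le (mixedNormPow_heatPicard_rpow_le hα0.le hp1 hq1 hh (hC T) hinvariant)).trans_lt
      hM
  · exact iSup_heatPicard_eq hh (by fun_prop) hmono le_rfl
      (ae_of_all _ fun _ a _ => (ennreal_iSup_rpow hα0 a).symm) x

end Majorant

section PowerNonlinearity

variable {α r : ℝ}

lemma powerNL_of_nonneg (hα : 0 < α) (hr : 0 ≤ r) : powerNL α r = r ^ α := by
  rcases hr.eq_or_lt with rfl | hr
  · rw [powerNL, mul_zero, Real.zero_rpow hα.ne']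
  · rw [powerNL, abs_of_pos hr, Real.rpow_sub_one hr.ne', div_mul_cancel₀ _ hr.ne']

lemma powerNL_neg (α r : ℝ) : powerNL α (-r) = -powerNL α r := by
  rw [powerNL, powerNL, abs_neg, mul_neg]

lemma enorm_powerNL (hα : 0 < α) (r : ℝ) : ‖powerNL α r‖ₑ = ‖r‖ₑ ^ α := by
  wlog hr : 0 ≤ r generalizing r
  · rw [← enorm_neg (powerNL α r), ← enorm_neg r, ← powerNL_neg]
    exact this _ (by linarith)
  rw [powerNL_of_nonneg hα hr, Real.enorm_of_nonneg hr, Real.enorm_of_nonneg (by positivity),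
    ENNReal.ofReal_rpow_of_nonneg hr hα.le]

/-- The map `r ↦ N(r - w) + N(w)` with `N(r) = |r|^{α-1} r`, which unlike `N` itself is nonnegative
as well as monotone on `[0, ∞]`, so that monotone iteration applies to it. The two truncated
differences stand for the two signs of `r - w`. -/
noncomputable def shiftedPower (α : ℝ) (w r : ℝ≥0∞) : ℝ≥0∞ :=
  (r - w) ^ α + (w ^ α - (w - r) ^ α)

variable {w z : ℝ≥0∞}

lemma monotone_shiftedPower (hα : 0 ≤ α) (w : ℝ≥0∞) : Monotone (shiftedPower α w) := by
  intro a b hab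
  unfold shiftedPower
  gcongr

lemma shiftedPower_le_two_mul (hα : 0 ≤ α) (h : z ≤ 2 * w) :
    shiftedPower α w z ≤ 2 * w ^ α := by
  rw [two_mul] at h ⊢
  exact add_le_add (ENNReal.rpow_le_rpow (tsub_le_iff_right.2 h) hα) tsub_le_self

lemma continuous_shiftedPower (hα : 0 ≤ α) (hw : w ≠ ⊤) : Continuous (shiftedPower α w) :=
  (ENNReal.continuous_rpow_const.comp (ENNReal.continuous_sub_right w)).add
    ((ENNReal.continuous_sub_left (ENNReal.rpow_ne_top_of_nonneg hα hw)).comp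
      (ENNReal.continuous_rpow_const.comp (ENNReal.continuous_sub_left hw)))

lemma iSup_shiftedPower (hα : 0 ≤ α) (hw : w ≠ ⊤) {a : ℕ → ℝ≥0∞} (ha : Monotone a) :
    ⨆ j, shiftedPower α w (a j) = shiftedPower α w (⨆ j, a j) :=
  tendsto_nhds_unique (tendsto_atTop_iSup ((monotone_shiftedPower hα w).comp ha))
    (((continuous_shiftedPower hα hw).tendsto _).comp (tendsto_atTop_iSup ha))

lemma measurable_shiftedPower {A : Type*} [MeasurableSpace A] {f g : A → ℝ≥0∞} (hf : Measurable f)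
    (hg : Measurable g) : Measurable fun a => shiftedPower α (f a) (g a) :=
  ((hg.sub hf).pow_const α).add ((hf.pow_const α).sub ((hf.sub hg).pow_const α))

lemma powerNL_toReal_sub_toReal (hα : 0 < α) (hw : w ≠ ⊤) (hz : z ≠ ⊤) :
    powerNL α (z.toReal - w.toReal) = (shiftedPower α w z).toReal - (w ^ α).toReal := by
  rcases le_total w z with h | h
  · rw [shiftedPower, tsub_eq_zero_of_le h, ENNReal.zero_rpow_of_pos hα, tsub_zero,
      ENNReal.toReal_add (by finiteness) (by finiteness), add_sub_cancel_right,
      ← ENNReal.toReal_sub_of_le h hz, powerNL_of_nonneg hα ENNReal.toReal_nonneg,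
      ENNReal.toReal_rpow]
  · have hpow : (w - z) ^ α ≤ w ^ α := ENNReal.rpow_le_rpow tsub_le_self hα.le
    rw [shiftedPower, tsub_eq_zero_of_le h, ENNReal.zero_rpow_of_pos hα, zero_add,
      ENNReal.toReal_sub_of_le hpow (by finiteness), sub_sub_cancel_left, ← neg_sub w.toReal,
      powerNL_neg, ← ENNReal.toReal_sub_of_le h hw, powerNL_of_nonneg hα ENNReal.toReal_nonneg,
      ENNReal.toReal_rpow]

lemma enorm_toReal_sub_toReal_le (h : z ≤ 2 * w) : ‖z.toReal - w.toReal‖ₑ ≤ w := by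
  rcases eq_or_ne w ⊤ with rfl | hw
  · exact le_top
  have h2 : z.toReal ≤ 2 * w.toReal := by
    simpa using ENNReal.toReal_mono (ENNReal.mul_ne_top ENNReal.ofNat_ne_top hw) h
  rw [Real.enorm_eq_ofReal_abs]
  refine ENNReal.ofReal_le_of_le_toReal (abs_le.2 ⟨?_, by linarith⟩)
  linarith [ENNReal.toReal_nonneg (a := z)]

end PowerNonlinearity

section BochnerDuhamel

variable {n : ℕ} {f g : Rn n → ℝ → ℝ≥0∞} {x : Rn n} {t : ℝ}

lemma measurable_enorm_heatKernel_mul (hf : Measurable (Function.uncurry f)) (x : Rn n) (t : ℝ) :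
    Measurable fun z : ℝ × Rn n => ‖heatKernel n (t - z.1) (x - z.2)‖ₑ * f z.2 z.1 :=
  Measurable.mul (by fun_prop) (hf.comp measurable_swap)

lemma heatDuhamel_eq_lintegral_prod (hf : Measurable (Function.uncurry f)) (x : Rn n) (t : ℝ) :
    heatDuhamel f x t = ∫⁻ z : ℝ × Rn n, ‖heatKernel n (t - z.1) (x - z.2)‖ₑ * f z.2 z.1
      ∂((volume.restrict (Ioo 0 t)).prod volume) := by
  rw [lintegral_prod _ (measurable_enorm_heatKernel_mul hf x t).aemeasurable]
  rfl

lemma toReal_enorm_heatKernel_mul_ae_eq (f : Rn n → ℝ → ℝ≥0∞) (x : Rn n) (t : ℝ) :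
    (fun z : ℝ × Rn n => (‖heatKernel n (t - z.1) (x - z.2)‖ₑ * f z.2 z.1).toReal)
      =ᵐ[(volume.restrict (Ioo 0 t)).prod volume]
        fun z => heatKernel n (t - z.1) (x - z.2) * (f z.2 z.1).toReal := by
  filter_upwards [Measure.quasiMeasurePreserving_fst.ae (ae_restrict_mem measurableSet_Ioo)]
    with z hz
  rw [ENNReal.toReal_mul, toReal_enorm, Real.norm_of_nonneg (heatKernel_pos (sub_pos.2 hz.2) _).le]

lemma integrable_heatKernel_mul_toReal (hf : Measurable (Function.uncurry f))
    (hfin : heatDuhamel f x t ≠ ⊤) :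
    Integrable (fun z : ℝ × Rn n => heatKernel n (t - z.1) (x - z.2) * (f z.2 z.1).toReal)
      ((volume.restrict (Ioo 0 t)).prod volume) := by
  rw [heatDuhamel_eq_lintegral_prod hf] at hfin
  exact (integrable_toReal_of_lintegral_ne_top
    (measurable_enorm_heatKernel_mul hf x t).aemeasurable hfin).congr
      (toReal_enorm_heatKernel_mul_ae_eq f x t)

lemma integral_heatKernel_mul_toReal (hf : Measurable (Function.uncurry f))
    (hfin : heatDuhamel f x t ≠ ⊤) :
    ∫ z : ℝ × Rn n, heatKernel n (t - z.1) (x - z.2) * (f z.2 z.1).toReal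
      ∂((volume.restrict (Ioo 0 t)).prod volume) = (heatDuhamel f x t).toReal := by
  have hmeas := measurable_enorm_heatKernel_mul hf x t
  rw [heatDuhamel_eq_lintegral_prod hf] at hfin ⊢
  rw [← integral_congr_ae (toReal_enorm_heatKernel_mul_ae_eq f x t),
    integral_toReal hmeas.aemeasurable (ae_lt_top hmeas hfin)]

lemma integrable_and_integral_heatKernel_mul_of_ae_eq_sub {φ : Rn n → ℝ → ℝ}
    (hf : Measurable (Function.uncurry f)) (hg : Measurable (Function.uncurry g))
    (hffin : heatDuhamel f x t ≠ ⊤) (hgfin : heatDuhamel g x t ≠ ⊤)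
    (hφ : ∀ᵐ z : ℝ × Rn n ∂((volume.restrict (Ioo 0 t)).prod volume),
      φ z.2 z.1 = (f z.2 z.1).toReal - (g z.2 z.1).toReal) :
    Integrable (fun z : ℝ × Rn n => heatKernel n (t - z.1) (x - z.2) * φ z.2 z.1)
      ((volume.restrict (Ioo 0 t)).prod volume) ∧
    ∫ s in Ioo 0 t, ∫ y, heatKernel n (t - s) (x - y) * φ y s =
      (heatDuhamel f x t).toReal - (heatDuhamel g x t).toReal := by
  have hf_int := integrable_heatKernel_mul_toReal hf hffin
  have hg_int := integrable_heatKernel_mul_toReal hg hgfin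
  have hsub : (fun z : ℝ × Rn n => heatKernel n (t - z.1) (x - z.2) * (f z.2 z.1).toReal -
      heatKernel n (t - z.1) (x - z.2) * (g z.2 z.1).toReal)
      =ᵐ[(volume.restrict (Ioo 0 t)).prod volume]
        fun z => heatKernel n (t - z.1) (x - z.2) * φ z.2 z.1 :=
    hφ.mono fun z hz => by simp only [hz, mul_sub]
  have hint := (hf_int.sub hg_int).congr hsub
  refine ⟨hint, ?_⟩
  rw [integral_integral (f := fun s y => heatKernel n (t - s) (x - y) * φ y s) hint,
    ← integral_congr_ae hsub, integral_sub hf_int hg_int, integral_heatKernel_mul_toReal hf hffin,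
    integral_heatKernel_mul_toReal hg hgfin]

lemma enorm_integral_heatKernel_powerNL_le {α : ℝ} (hα : 0 < α) (u : Rn n → ℝ → ℝ) (x : Rn n)
    (t : ℝ) : ‖∫ s in Ioo 0 t, ∫ y, heatKernel n (t - s) (x - y) * powerNL α (u y s)‖ₑ ≤
      heatDuhamel (fun y s => ‖u y s‖ₑ ^ α) x t :=
  calc ‖∫ s in Ioo 0 t, ∫ y, heatKernel n (t - s) (x - y) * powerNL α (u y s)‖ₑ
      ≤ ∫⁻ s in Ioo 0 t, ‖∫ y, heatKernel n (t - s) (x - y) * powerNL α (u y s)‖ₑ :=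
        enorm_integral_le_lintegral_enorm _
    _ ≤ ∫⁻ s in Ioo 0 t, ∫⁻ y, ‖heatKernel n (t - s) (x - y) * powerNL α (u y s)‖ₑ :=
        lintegral_mono fun _ => enorm_integral_le_lintegral_enorm _
    _ = heatDuhamel (fun y s => ‖u y s‖ₑ ^ α) x t := by
        simp only [enorm_mul, enorm_powerNL hα, heatDuhamel, lheatExtension]

end BochnerDuhamel

section SignedSolution

variable {n : ℕ} {α T : ℝ} {w H : Rn n → ℝ → ℝ≥0∞}

lemma ae_prod_ne_top_of_ae_forall (hw : Measurable (Function.uncurry w))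
    (hfin : ∀ᵐ x, ∀ t ∈ Ioo 0 T, w x t ≠ ⊤) :
    ∀ᵐ z ∂(volume.prod (volume.restrict (Ioo 0 T))), w z.1 z.2 ≠ ⊤ := by
  have hmeas : MeasurableSet {z : Rn n × ℝ | w z.1 z.2 ≠ ⊤} :=
    (hw (measurableSet_singleton ⊤)).compl
  rw [Measure.ae_prod_iff_ae_ae hmeas]
  filter_upwards [hfin] with x hx
  exact (ae_restrict_iff' measurableSet_Ioo).2 (ae_of_all _ hx)

lemma exists_eq_add_heatDuhamel_shiftedPower (hα : 0 ≤ α) (hH : Measurable (Function.uncurry H))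
    (hw : Measurable (Function.uncurry w))
    (hsuper : ∀ x t, H x t + 2 * heatDuhamel (fun y s => w y s ^ α) x t ≤ 2 * w x t)
    (hfin : ∀ᵐ z ∂(volume.prod (volume.restrict (Ioo 0 T))), w z.1 z.2 ≠ ⊤) :
    ∃ z : Rn n → ℝ → ℝ≥0∞, Measurable (Function.uncurry z) ∧ (∀ x t, z x t ≤ 2 * w x t) ∧
      ∀ x, ∀ t ≤ T,
        z x t = H x t + heatDuhamel (fun y s => shiftedPower α (w y s) (z y s)) x t := by
  have hG : Measurable fun v : (Rn n × ℝ) × ℝ≥0∞ => shiftedPower α (w v.1.1 v.1.2) v.2 :=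
    measurable_shiftedPower (hw.comp measurable_fst) measurable_snd
  have hmono : ∀ y s, Monotone (shiftedPower α (w y s)) := fun y s =>
    monotone_shiftedPower hα (w y s)
  have hsuper' : ∀ x t, H x t +
      heatDuhamel (fun y s => shiftedPower α (w y s) (2 * w y s)) x t ≤ 2 * w x t := fun x t => by
    refine (add_le_add_right ?_ _).trans (hsuper x t)
    rw [← heatDuhamel_const_mul ENNReal.ofNat_ne_top]
    exact heatDuhamel_mono (fun y s => shiftedPower_le_two_mul hα le_rfl) x t
  refine ⟨fun x t => ⨆ j, heatPicard H (fun y s => shiftedPower α (w y s)) j x t,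
    Measurable.iSup (measurable_heatPicard hH hG),
    fun x t => iSup_le fun j => heatPicard_le_of_supersolution hmono hsuper' j x t,
    fun x t ht => iSup_heatPicard_eq hH hG hmono ht ?_ x⟩
  exact hfin.mono fun z hz a ha => iSup_shiftedPower hα hz ha

lemma ae_powerNL_toReal_sub_toReal (hα : 0 < α) {t : ℝ} (htT : t ≤ T)
    {z : Rn n → ℝ → ℝ≥0∞} (hzw : ∀ x t, z x t ≤ 2 * w x t)
    (hfin : ∀ᵐ z ∂(volume.prod (volume.restrict (Ioo 0 T))), w z.1 z.2 ≠ ⊤) :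
    ∀ᵐ v : ℝ × Rn n ∂((volume.restrict (Ioo 0 t)).prod volume),
      powerNL α ((z v.2 v.1).toReal - (w v.2 v.1).toReal) =
        (shiftedPower α (w v.2 v.1) (z v.2 v.1)).toReal - (w v.2 v.1 ^ α).toReal := by
  have hle : (volume.restrict (Ioo 0 t)).prod (volume : Measure (Rn n)) ≤
      (volume.restrict (Ioo 0 T)).prod volume :=
    Measure.prod_mono (Measure.restrict_mono_set _ (Ioo_subset_Ioo_right htT)) le_rfl
  filter_upwards [ae_mono hle
    (Measure.measurePreserving_swap.quasiMeasurePreserving.ae hfin)] with v hv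
  exact powerNL_toReal_sub_toReal hα hv
    (ne_top_of_le_ne_top (ENNReal.mul_ne_top ENNReal.ofNat_ne_top hv) (hzw _ _))

lemma exists_eq_add_integral_heatKernel_powerNL (hα : 0 < α) {h : Rn n → ℝ → ℝ}
    (hh : Measurable (Function.uncurry h)) (hw : Measurable (Function.uncurry w))
    (hw_eq : ∀ x t, w x t = ‖h x t‖ₑ + heatDuhamel (fun y s => w y s ^ α) x t)
    (hfin : ∀ᵐ x, ∀ t ∈ Ioo 0 T, heatDuhamel (fun y s => w y s ^ α) x t < ⊤) :
    ∃ u : Rn n → ℝ → ℝ, Measurable (Function.uncurry u) ∧ (∀ x t, ‖u x t‖ₑ ≤ w x t) ∧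
      ∀ᵐ x, ∀ t ∈ Ioo 0 T,
        Integrable (fun z : ℝ × Rn n => heatKernel n (t - z.1) (x - z.2) * powerNL α (u z.2 z.1))
          ((volume.restrict (Ioo 0 t)).prod volume) ∧
        u x t = h x t + ∫ s in Ioo 0 t, ∫ y, heatKernel n (t - s) (x - y) * powerNL α (u y s) := by
  have hsuper : ∀ x t, ENNReal.ofReal (h x t + |h x t|) +
      2 * heatDuhamel (fun y s => w y s ^ α) x t ≤ 2 * w x t := fun x t => by
    rw [hw_eq x t, mul_add, Real.enorm_eq_ofReal_abs, two_mul (ENNReal.ofReal _),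
      ← ENNReal.ofReal_add (abs_nonneg _) (abs_nonneg _)]
    gcongr
    exact le_abs_self _
  have hw_fin : ∀ᵐ x, ∀ t ∈ Ioo 0 T, w x t ≠ ⊤ := hfin.mono fun x hx t ht => by
    rw [hw_eq]
    exact ENNReal.add_ne_top.2 ⟨enorm_ne_top, (hx t ht).ne⟩
  have hw_fin_prod := ae_prod_ne_top_of_ae_forall hw hw_fin
  obtain ⟨z, hz, hzw, hz_eq⟩ := exists_eq_add_heatDuhamel_shiftedPower hα.le
    (H := fun x t => ENNReal.ofReal (h x t + |h x t|)) (hh.add hh.abs).ennreal_ofReal hw hsuper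
    hw_fin_prod
  refine ⟨fun x t => (z x t).toReal - (w x t).toReal, hz.ennreal_toReal.sub hw.ennreal_toReal,
    fun x t => enorm_toReal_sub_toReal_le (hzw x t), ?_⟩
  filter_upwards [hfin, hw_fin] with x hDw hwx t ht
  have hDz : heatDuhamel (fun y s => shiftedPower α (w y s) (z y s)) x t ≠ ⊤ :=
    ne_top_of_le_ne_top (ENNReal.mul_ne_top ENNReal.ofNat_ne_top (hwx t ht))
      (le_add_self.trans ((hz_eq x t ht.2.le).ge.trans (hzw x t)))
  obtain ⟨hint, hint_eq⟩ := integrable_and_integral_heatKernel_mul_of_ae_eq_sub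
    (f := fun y s => shiftedPower α (w y s) (z y s)) (g := fun y s => w y s ^ α)
    (φ := fun y s => powerNL α ((z y s).toReal - (w y s).toReal))
    (measurable_shiftedPower hw hz) (hw.pow_const α) hDz (hDw t ht).ne
    (ae_powerNL_toReal_sub_toReal hα ht.2.le hzw hw_fin_prod)
  refine ⟨hint, ?_⟩
  rw [hint_eq, hz_eq x t ht.2.le, hw_eq x t, ENNReal.toReal_add ENNReal.ofReal_ne_top hDz,
    ENNReal.toReal_add enorm_ne_top (hDw t ht).ne,
    ENNReal.toReal_ofReal (by linarith [neg_abs_le (h x t)]), toReal_enorm, Real.norm_eq_abs]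
  ring

end SignedSolution

section InitialData

variable {n : ℕ} {p : ℝ} {U v : Rn n → ℝ}

lemma MemWeightedLp.aestronglyMeasurable (hv : IsWeight v) (hU : MemWeightedLp p v U) :
    AEStronglyMeasurable U :=
  hU.1.mono_ac (withDensity_absolutelyContinuous' hv.measurable.ennreal_ofReal.aemeasurable
    (ae_of_all _ fun x => (ENNReal.ofReal_pos.2 (hv.pos x)).ne'))

lemma MemWeightedLp.memLp_rpow_mul (hp : 0 < p) (hv : IsWeight v) (hU : MemWeightedLp p v U) :
    MemLp (fun y => v y ^ (1 / p) * U y) (ENNReal.ofReal p) := by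
  have hU_meas := hU.aestronglyMeasurable hv
  refine ⟨(hv.measurable.pow_const _).aestronglyMeasurable.mul hU_meas, ?_⟩
  have hU_lt := hU.2
  rw [eLpNorm_lt_top_iff_lintegral_rpow_enorm_lt_top (by simpa using hp) ENNReal.ofReal_ne_top,
    ENNReal.toReal_ofReal hp.le] at hU_lt ⊢
  rw [lintegral_withDensity_eq_lintegral_mul₀ hv.measurable.ennreal_ofReal.aemeasurable
    (hU_meas.enorm.pow_const p)] at hU_lt
  refine lt_of_eq_of_lt (lintegral_congr fun y => ?_) hU_lt
  have hvy := hv.pos y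
  rw [Pi.mul_apply, enorm_mul, ENNReal.mul_rpow_of_nonneg _ _ hp.le,
    Real.enorm_of_nonneg (by positivity), ENNReal.ofReal_rpow_of_nonneg (by positivity) hp.le,
    ← Real.rpow_mul hvy.le, one_div_mul_cancel hp.ne', Real.rpow_one]

lemma WeightClassD.exists_integrable_heatKernel_mul (hp : 1 ≤ p) (hv : WeightClassD p v)
    (hU : MemWeightedLp p v U) :
    ∃ t₀ > 0, ∃ x₀, Integrable fun y => heatKernel n t₀ (x₀ - y) * U y := by
  obtain ⟨hw, t₀, ht₀, x₀, hK⟩ := hv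
  have : ENNReal.HolderConjugate (ENNReal.ofReal p) (ENNReal.conjExponent (ENNReal.ofReal p)) :=
    .conjExponent (by simpa using hp)
  refine ⟨t₀, ht₀, x₀, ((hU.memLp_rpow_mul (by linarith) hw).integrable_mul hK).congr
    (ae_of_all _ fun y => ?_)⟩
  have hcancel : v y ^ (1 / p) * v y ^ (-1 / p) = 1 := by
    rw [← Real.rpow_add (hw.pos y), ← add_div, add_neg_cancel, zero_div, Real.rpow_zero]
  calc v y ^ (1 / p) * U y * (v y ^ (-1 / p) * heatKernel n t₀ (x₀ - y))
      = v y ^ (1 / p) * v y ^ (-1 / p) * (heatKernel n t₀ (x₀ - y) * U y) := by ring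
    _ = heatKernel n t₀ (x₀ - y) * U y := by rw [hcancel, one_mul]

lemma measurable_heatExtension (hU : AEStronglyMeasurable U) :
    Measurable (Function.uncurry (heatExtension U)) := by
  have hmk : Function.uncurry (heatExtension U) = fun z : Rn n × ℝ =>
      ∫ y, heatKernel n z.2 (z.1 - y) * hU.mk U y := by
    funext z
    exact integral_congr_ae (hU.ae_eq_mk.mono fun y hy => congrArg (_ * ·) hy)
  rw [hmk]
  refine (StronglyMeasurable.integral_prod_right' (f := fun w : (Rn n × ℝ) × Rn n =>
    heatKernel n w.1.2 (w.1.1 - w.2) * hU.mk U w.2) (Measurable.stronglyMeasurable ?_)).measurable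
  exact Measurable.mul (by fun_prop) (hU.stronglyMeasurable_mk.measurable.comp measurable_snd)

end InitialData

section MildSolution

variable {n : ℕ} {α p q k T : ℝ} {U : Rn n → ℝ} {u : Rn n → ℝ → ℝ}

lemma MemX.ae_tendsto_integral_heatKernel_powerNL (hα : 0 < α) (hαp : α < p) (hαq : α < q)
    (hκ : k * α / (q - α) < 1) (hT : 0 < T) (hu : MemX p q k T u) :
    ∀ᵐ x, Tendsto (fun t => ∫ s in Ioo 0 t, ∫ y, heatKernel n (t - s) (x - y) *
      powerNL α (u y s)) (𝓝[>] 0) (𝓝 0) := by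
  obtain ⟨hmeas, hfin⟩ := hu
  set g : Rn n → ℝ → ℝ≥0∞ := fun x t => ‖hmeas.mk _ (x, t)‖ₑ
  have hg : Measurable (Function.uncurry g) := hmeas.stronglyMeasurable_mk.measurable.enorm
  have hug : ∀ᵐ z ∂(volume.prod (volume.restrict (Ioo 0 T))), ‖u z.1 z.2‖ₑ = g z.1 z.2 :=
    hmeas.ae_eq_mk.mono fun _ hz => congrArg enorm hz
  have hg_fin : mixedNormPow p q k T g < ⊤ :=
    (mixedNormPow_congr_enorm_ae hug).symm.trans_lt hfin
  filter_upwards [ae_lintegral_heatMaximal_rpow_lt_top hα hαp hαq hκ hT hg hg_fin] with x hx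
  rw [tendsto_zero_iff_enorm_tendsto_zero]
  refine tendsto_of_tendsto_of_tendsto_of_le_of_le' tendsto_const_nhds
    (tendsto_heatDuhamel_zero hT hx) (Eventually.of_forall fun _ => zero_le) ?_
  filter_upwards [Ioo_mem_nhdsGT hT] with t ht
  exact (enorm_integral_heatKernel_powerNL_le hα u x t).trans_eq
    (heatDuhamel_congr_ae ht.2.le (hug.mono fun z hz => congrArg (· ^ α) hz) x)

lemma IsMildSolution.ae_tendsto (hu : IsMildSolution α T U u) (hα : 0 < α) (hαp : α < p)
    (hαq : α < q) (hκ : k * α / (q - α) < 1) (hT : 0 < T) (huX : MemX p q k T u) :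
    ∀ᵐ x, Tendsto (u x) (𝓝[>] 0) (𝓝 (U x)) := by
  have hhalf : T / 2 ∈ Ioo 0 T := ⟨by linarith, by linarith⟩
  filter_upwards [hu, ae_tendsto_heatExtension hhalf.1 (hu.mono fun x hx => (hx _ hhalf).1),
    huX.ae_tendsto_integral_heatKernel_powerNL hα hαp hαq hκ hT] with x hx hheat hduhamel
  have hlim := hheat.add hduhamel
  rw [add_zero] at hlim
  refine hlim.congr' ?_
  filter_upwards [Ioo_mem_nhdsGT hT] with t ht
  exact (hx t ht).2.2.symm

lemma exists_isMildSolution (hα : 1 ≤ α) (hαp : α < p) (hαq : α < q)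
    (hκ : k * α / (q - α) < 1) (hβ : (n : ℝ) / 2 * ((α - 1) / p) * (q / (q - α)) < 1)
    (hexp : -1 < k + (q - α) *
      (1 - (n : ℝ) / 2 * ((α - 1) / p) * (q / (q - α)) - k * α / (q - α)))
    {T₀ t₀ : ℝ} {x₀ : Rn n} (hT₀ : 0 < T₀) (hUX : MemX p q k T₀ (heatExtension U)) (ht₀ : 0 < t₀)
    (hU : Integrable fun y => heatKernel n t₀ (x₀ - y) * U y) :
    ∃ T ∈ Ioc 0 T₀, ∃ u, MemX p q k T u ∧ IsMildSolution α T U u := by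
  have hα0 : 0 < α := by linarith
  have ht₀' : 0 < t₀ / 2 := half_pos ht₀
  have hU' : Integrable fun y => heatKernel n (2 * (t₀ / 2)) (x₀ - y) * U y := by
    rwa [mul_div_cancel₀ t₀ two_ne_zero]
  have hint : ∀ t ∈ Ioc 0 (t₀ / 2), ∀ x, Integrable fun y => heatKernel n t (x - y) * U y :=
    fun t ht x => integrable_heatKernel_mul_of_time_le ht.1 ht.2
      (integrable_heatKernel_mul_of_integrable_two_mul ht₀' hU' x)
  have hUm := measurable_heatExtension
    (locallyIntegrable_of_integrable_heatKernel_mul ht₀ hU).aestronglyMeasurable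
  have hfin : mixedNormPow p q k (min T₀ (t₀ / 2)) (fun x t => ‖heatExtension U x t‖ₑ) < ⊤ :=
    (mixedNormPow_mono_enorm (by linarith) fun _ _ => (enorm_enorm _).le).trans_lt
      ((mixedNormPow_mono_time (min_le_left _ _) _).trans_lt hUX.2)
  obtain ⟨T, ⟨hT, hT_le⟩, w, hw, hw_fin, hw_eq⟩ := exists_eq_add_heatDuhamel_rpow
    hα hαp.le hαq hκ hβ hexp (lt_min hT₀ ht₀') (h := fun x t => ‖heatExtension U x t‖ₑ)
    hUm.enorm hfin
  have hDw : ∀ᵐ x, ∀ t ∈ Ioo 0 T, heatDuhamel (fun y s => w y s ^ α) x t < ⊤ :=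
    (ae_lintegral_heatMaximal_rpow_lt_top hα0 hαp hαq hκ hT hw hw_fin).mono fun _ hx _ ht =>
      heatDuhamel_lt_top_of_lintegral_heatMaximal ht.2.le hx
  obtain ⟨u, hu, huw, hu_eq⟩ := exists_eq_add_integral_heatKernel_powerNL hα0 hUm hw hw_eq hDw
  refine ⟨T, ⟨hT, hT_le.trans (min_le_left _ _)⟩, u, ⟨hu.aestronglyMeasurable,
    (mixedNormPow_mono_enorm (by linarith) huw).trans_lt hw_fin⟩, ?_⟩
  filter_upwards [hu_eq] with x hx t ht
  exact ⟨hint t ⟨ht.1, ht.2.le.trans (hT_le.trans (min_le_right _ _))⟩ x, hx t ht⟩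

end MildSolution

theorem mainTheorem8_general {n : ℕ} {α p q k T₀ t₀ : ℝ} (hα : 1 ≤ α) (hT₀ : 0 < T₀)
    (hpq : α < min p q) (hkα : k * α / (q - α) < 1)
    (hβ : (n : ℝ) / 2 * ((α - 1) / p) * (q / (q - α)) < 1)
    (hexp : -1 < k + (q - α) *
      (1 - (n : ℝ) / 2 * ((α - 1) / p) * (q / (q - α)) - k * α / (q - α)))
    {U : Rn n → ℝ} (hh : MemX p q k T₀ (heatExtension U)) (ht₀ : 0 < t₀) {x₀ : Rn n}
    (hU : Integrable fun y => heatKernel n t₀ (x₀ - y) * U y) :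
    (∃ T : ℝ, 0 < T ∧ T ≤ T₀ ∧ ∃ u : Rn n → ℝ → ℝ, MemX p q k T u ∧ IsMildSolution α T U u) ∧
    ∀ T : ℝ, 0 < T → ∀ u : Rn n → ℝ → ℝ, MemX p q k T u → IsMildSolution α T U u →
      ∀ᵐ x : Rn n, Tendsto (fun t => u x t) (𝓝[>] 0) (𝓝 (U x)) := by
  obtain ⟨hαp, hαq⟩ := lt_min_iff.1 hpq
  obtain ⟨T, hT, u, hu⟩ := exists_isMildSolution hα hαp hαq hkα hβ hexp hT₀ hh ht₀ hU
  exact ⟨⟨T, hT.1, hT.2, u, hu⟩, fun T hT u huX hu =>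
    hu.ae_tendsto (by linarith) hαp hαq hkα hT huX⟩

theorem mainTheorem8 (n : ℕ) (hn : 1 ≤ n) (α p q k T₀ : ℝ)
    (hα : 1 < α) (hk : 0 < k) (hT₀ : 0 < T₀)
    (hpq : α < min p q)
    (hkα : k * α / (q - α) < 1)
    (hβ : (n : ℝ) / 2 * ((α - 1) / p) * (q / (q - α)) < 1)
    (hexp : -1 < k + (q - α) *
      (1 - (n : ℝ) / 2 * ((α - 1) / p) * (q / (q - α)) - k * α / (q - α)))
    (hkq : k < q - 1)
    (U v : Rn n → ℝ)
    (hh : MemX p q k T₀ (heatExtension U))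
    (hv : WeightClassD p v) (hU : MemWeightedLp p v U) :
    (∃ T : ℝ, 0 < T ∧ T ≤ T₀ ∧ ∃ u : Rn n → ℝ → ℝ, MemX p q k T u ∧ IsMildSolution α T U u) ∧
    ∀ T : ℝ, 0 < T → ∀ u : Rn n → ℝ → ℝ, MemX p q k T u → IsMildSolution α T U u →
      ∀ᵐ x : Rn n, Tendsto (fun t => u x t) (𝓝[>] 0) (𝓝 (U x)) := by
  obtain ⟨t₀, ht₀, x₀, hint⟩ :=
    hv.exists_integrable_heatKernel_mul (hα.le.trans (lt_min_iff.1 hpq).1.le) hU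
  exact mainTheorem8_general hα.le hT₀ hpq hkα hβ hexp hh ht₀ hint
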